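/- **Theorem (coherence for normal (op)lax symmetric monoidal functors).** Let $C$ and $D$ be symmetric monoidal categories and let $F\colon C\to D$ be a lax symmetric monoidal functor that is *normal*, i.e. its unit map $I_D\to F(I_C)$ is an isomorphism. For a set $T$, let $\mathcal F(T)$ be the free symmetric monoidal category on $T$, and let $\Phi\colon\mathcal F(T)\to\mathcal E(T)$ be the free normal lax symmetric monoidal functor on $T$. Explicitly, the objects of $\mathcal E(T)$ are the parenthesized words in formal units and terms $\Phi(W)$ with $W$ an object of $\mathcal F(T)$. Its morphisms are generated, under composition and tensoring with identities, by the associators, unitors and symmetries of $\mathcal E(T)$, the maps $\Phi(f)$ for $f$ in $\mathcal F(T)$, the composition maps $\Phi(W)\otimes\Phi(W')\to\Phi(W\otimes W')$, the unit map $I\to\Phi(I)$ and its inverse, subject exactly to the axioms of a symmetric monoidal category and of a normal lax symmetric monoidal functor. Each morphism of $\mathcal E(T)$ has an *underlying permutation*: the bijection it induces from the occurrences of letters of $T$ in its source to those in its target. With $T=\operatorname{ob}C$ there is a canonical strict symmetric monoidal functor $\mathcal E(\operatorname{ob}C)\to D$, which sends $\Phi(W)$ to $F$ of the value of $W$ in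 $C$ and the generators to the corresponding structure maps of $C$, $D$ and $F$. 1. Let $\Delta\colon J\to D$ be a *formal diagram*, i.e. a functor with a lift $K\colon J\to\mathcal E(\operatorname{ob} C)$ along $\mathcal E(\operatorname{ob}C)\to D$. If for every pair of parallel morphisms $f,g$ of $J$ the morphisms $K(f)$ and $K(g)$ have the same underlying permutation, then $\Delta$ commutes: $\Delta(f)=\Delta(g)$ for all parallel $f,g$ in $J$. In other words, any two parallel formal morphisms with the same underlying permutation agree in $D$. 2. The same holds for normal oplax symmetric monoidal functors, i.e. oplax symmetric monoidal functors whose counit map $F(I_C)\to I_D$ is an isomorphism, with $\mathcal E(T)$ replaced by the target of the free normal oplax symmetric monoidal functor on $T$ (the maps now being $\Phi(W\otimes W')\to\Phi(W)\otimes\Phi(W')$ and $\Phi(I)\to I$, the latter with an inverse). 3. For every $n\ge 0$, let $\mathbf{Fin}$ be the category of the sets $\{1,\dots,k\}$, $k\ge0$, and all maps between them. The localization $(\underline n\downarrow\mathbf{Fin})[\mathcal I^{-1}]$ of the category of objects of $\mathbf{Fin}$ under $\{1,\dots,n\}$ at the injective order-preserving maps is thin: there is at most one morphism between any two objects. -/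

import Mathlib

open CategoryTheory MonoidalCategory

universe w w' v v₁ u u₁

namespace SymCoh

/-! ### Symmetric monoidal categories presented by generators and relations -/

/-- Parenthesized words in letters from `L` and formal units. -/
inductive Word (L : Type u) : Type u
  | of : L → Word L
  | unit : Word L
  | tensor : Word L → Word L → Word L

/-- Formal morphisms between words, generated by the structure maps of a symmetric monoidal
category (and their inverses) and by the generators `G`, under composition and whiskering. -/
inductive Hom {L : Type u} (G : Word L → Word L → Type u) : Word L → Word L → Type u
  | id (X : Word L) : Hom G X X
  | comp {X Y Z : Word L} (f : Hom G X Y) (g : Hom G Y Z) : Hom G X Z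
  | whiskerLeft (X : Word L) {Y Y' : Word L} (f : Hom G Y Y') : Hom G (X.tensor Y) (X.tensor Y')
  | whiskerRight {X X' : Word L} (f : Hom G X X') (Y : Word L) : Hom G (X.tensor Y) (X'.tensor Y)
  | assocHom (X Y Z : Word L) : Hom G ((X.tensor Y).tensor Z) (X.tensor (Y.tensor Z))
  | assocInv (X Y Z : Word L) : Hom G (X.tensor (Y.tensor Z)) ((X.tensor Y).tensor Z)
  | leftHom (X : Word L) : Hom G (Word.unit.tensor X) X
  | leftInv (X : Word L) : Hom G X (Word.unit.tensor X)
  | rightHom (X : Word L) : Hom G (X.tensor Word.unit) X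
  | rightInv (X : Word L) : Hom G X (X.tensor Word.unit)
  | braid (X Y : Word L) : Hom G (X.tensor Y) (Y.tensor X)
  | gen {X Y : Word L} (g : G X Y) : Hom G X Y

/-- The congruence on formal morphisms generated by the axioms of a symmetric monoidal category
and by the additional relations `R`. -/
inductive Rel {L : Type u} {G : Word L → Word L → Type u}
    (R : ∀ {X Y : Word L}, Hom G X Y → Hom G X Y → Prop) :
    ∀ {X Y : Word L}, Hom G X Y → Hom G X Y → Prop
  | of_rel {X Y} {f g : Hom G X Y} : R f g → Rel R f g
  | refl {X Y} (f : Hom G X Y) : Rel R f f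
  | symm {X Y} {f g : Hom G X Y} : Rel R f g → Rel R g f
  | trans {X Y} {f g h : Hom G X Y} : Rel R f g → Rel R g h → Rel R f h
  | comp {X Y Z} {f f' : Hom G X Y} {g g' : Hom G Y Z} :
      Rel R f f' → Rel R g g' → Rel R (f.comp g) (f'.comp g')
  | whiskerLeft (X) {Y Y'} {f f' : Hom G Y Y'} :
      Rel R f f' → Rel R (f.whiskerLeft X) (f'.whiskerLeft X)
  | whiskerRight {X X'} {f f' : Hom G X X'} (Y) :
      Rel R f f' → Rel R (f.whiskerRight Y) (f'.whiskerRight Y)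
  | id_comp {X Y} (f : Hom G X Y) : Rel R ((Hom.id X).comp f) f
  | comp_id {X Y} (f : Hom G X Y) : Rel R (f.comp (Hom.id Y)) f
  | assoc {W X Y Z} (f : Hom G W X) (g : Hom G X Y) (h : Hom G Y Z) :
      Rel R ((f.comp g).comp h) (f.comp (g.comp h))
  | whiskerLeft_id (X Y) : Rel R ((Hom.id Y).whiskerLeft X) (Hom.id (X.tensor Y))
  | whiskerLeft_comp (X) {Y Y' Y''} (f : Hom G Y Y') (g : Hom G Y' Y'') :
      Rel R ((f.comp g).whiskerLeft X) ((f.whiskerLeft X).comp (g.whiskerLeft X))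
  | id_whiskerRight (X Y) : Rel R ((Hom.id X).whiskerRight Y) (Hom.id (X.tensor Y))
  | comp_whiskerRight {X X' X''} (f : Hom G X X') (g : Hom G X' X'') (Y) :
      Rel R ((f.comp g).whiskerRight Y) ((f.whiskerRight Y).comp (g.whiskerRight Y))
  | whisker_exchange {X X' Y Y'} (f : Hom G X X') (g : Hom G Y Y') :
      Rel R ((f.whiskerRight Y).comp (g.whiskerLeft X'))
        ((g.whiskerLeft X).comp (f.whiskerRight Y'))
  | assoc_hom_inv (X Y Z) :
      Rel R ((Hom.assocHom X Y Z).comp (Hom.assocInv X Y Z)) (Hom.id _)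
  | assoc_inv_hom (X Y Z) :
      Rel R ((Hom.assocInv X Y Z).comp (Hom.assocHom X Y Z)) (Hom.id _)
  | left_hom_inv (X) : Rel R ((Hom.leftHom X).comp (Hom.leftInv X)) (Hom.id _)
  | left_inv_hom (X) : Rel R ((Hom.leftInv X).comp (Hom.leftHom X)) (Hom.id _)
  | right_hom_inv (X) : Rel R ((Hom.rightHom X).comp (Hom.rightInv X)) (Hom.id _)
  | right_inv_hom (X) : Rel R ((Hom.rightInv X).comp (Hom.rightHom X)) (Hom.id _)
  | assoc_nat_left {X X'} (f : Hom G X X') (Y Z) :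
      Rel R (((f.whiskerRight Y).whiskerRight Z).comp (Hom.assocHom X' Y Z))
        ((Hom.assocHom X Y Z).comp (f.whiskerRight (Y.tensor Z)))
  | assoc_nat_middle (X) {Y Y'} (f : Hom G Y Y') (Z) :
      Rel R (((f.whiskerLeft X).whiskerRight Z).comp (Hom.assocHom X Y' Z))
        ((Hom.assocHom X Y Z).comp ((f.whiskerRight Z).whiskerLeft X))
  | assoc_nat_right (X Y) {Z Z'} (f : Hom G Z Z') :
      Rel R ((f.whiskerLeft (X.tensor Y)).comp (Hom.assocHom X Y Z'))
        ((Hom.assocHom X Y Z).comp ((f.whiskerLeft Y).whiskerLeft X))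
  | left_nat {X X'} (f : Hom G X X') :
      Rel R ((f.whiskerLeft Word.unit).comp (Hom.leftHom X')) ((Hom.leftHom X).comp f)
  | right_nat {X X'} (f : Hom G X X') :
      Rel R ((f.whiskerRight Word.unit).comp (Hom.rightHom X')) ((Hom.rightHom X).comp f)
  | pentagon (W X Y Z) :
      Rel R (((Hom.assocHom W X Y).whiskerRight Z).comp
          ((Hom.assocHom W (X.tensor Y) Z).comp ((Hom.assocHom X Y Z).whiskerLeft W)))
        ((Hom.assocHom (W.tensor X) Y Z).comp (Hom.assocHom W X (Y.tensor Z)))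
  | triangle (X Y) :
      Rel R ((Hom.assocHom X Word.unit Y).comp ((Hom.leftHom Y).whiskerLeft X))
        ((Hom.rightHom X).whiskerRight Y)
  | braid_braid (X Y) : Rel R ((Hom.braid X Y).comp (Hom.braid Y X)) (Hom.id _)
  | braid_nat_left {X X'} (f : Hom G X X') (Y) :
      Rel R ((f.whiskerRight Y).comp (Hom.braid X' Y)) ((Hom.braid X Y).comp (f.whiskerLeft Y))
  | braid_nat_right (X) {Y Y'} (f : Hom G Y Y') :
      Rel R ((f.whiskerLeft X).comp (Hom.braid X Y')) ((Hom.braid X Y).comp (f.whiskerRight X))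
  | hexagon_forward (X Y Z) :
      Rel R ((Hom.assocHom X Y Z).comp ((Hom.braid X (Y.tensor Z)).comp (Hom.assocHom Y Z X)))
        (((Hom.braid X Y).whiskerRight Z).comp
          ((Hom.assocHom Y X Z).comp ((Hom.braid X Z).whiskerLeft Y)))
  | hexagon_reverse (X Y Z) :
      Rel R ((Hom.assocInv X Y Z).comp ((Hom.braid (X.tensor Y) Z).comp (Hom.assocInv Z X Y)))
        (((Hom.braid Y Z).whiskerLeft X).comp
          ((Hom.assocInv X Z Y).comp ((Hom.braid X Z).whiskerRight Y)))

/-- The symmetric monoidal category presented by object generators `L`, morphism generators `G`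
and relations `R`: objects are words in `L`, morphisms are formal morphisms modulo `Rel R`. -/
def Presented {L : Type u} (G : Word L → Word L → Type u)
    (_R : ∀ {X Y : Word L}, Hom G X Y → Hom G X Y → Prop) : Type u := Word L

section Presented

variable {L : Type u} {G : Word L → Word L → Type u}
  {R : ∀ {X Y : Word L}, Hom G X Y → Hom G X Y → Prop}

abbrev homSetoid (R : ∀ {X Y : Word L}, Hom G X Y → Hom G X Y → Prop) (X Y : Word L) :
    Setoid (Hom G X Y) :=
  ⟨Rel R, Rel.refl, Rel.symm, Rel.trans⟩

instance : Category.{u} (Presented G R) where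
  Hom X Y := Quotient (homSetoid (G := G) R X Y)
  id X := Quotient.mk _ (Hom.id X)
  comp := Quotient.map₂ Hom.comp (fun _ _ hf _ _ hg => Rel.comp hf hg)
  id_comp := by rintro X Y ⟨f⟩; exact Quotient.sound (Rel.id_comp f)
  comp_id := by rintro X Y ⟨f⟩; exact Quotient.sound (Rel.comp_id f)
  assoc := by rintro W X Y Z ⟨f⟩ ⟨g⟩ ⟨h⟩; exact Quotient.sound (Rel.assoc f g h)

/-- The morphism represented by a formal morphism. -/
def homMk (R : ∀ {X Y : Word L}, Hom G X Y → Hom G X Y → Prop) {X Y : Word L} (f : Hom G X Y) :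
    @Quiver.Hom (Presented G R) _ X Y :=
  Quotient.mk _ f

instance : MonoidalCategoryStruct (Presented G R) where
  tensorObj X Y := Word.tensor X Y
  whiskerLeft X _ _ := Quotient.map (Hom.whiskerLeft X) (fun _ _ h => Rel.whiskerLeft X h)
  whiskerRight f Y :=
    Quotient.map (fun f => Hom.whiskerRight f Y) (fun _ _ h => Rel.whiskerRight Y h) f
  tensorUnit := Word.unit
  associator X Y Z :=
    ⟨homMk R (Hom.assocHom X Y Z), homMk R (Hom.assocInv X Y Z),
      Quotient.sound (Rel.assoc_hom_inv X Y Z), Quotient.sound (Rel.assoc_inv_hom X Y Z)⟩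
  leftUnitor X :=
    ⟨homMk R (Hom.leftHom X), homMk R (Hom.leftInv X),
      Quotient.sound (Rel.left_hom_inv X), Quotient.sound (Rel.left_inv_hom X)⟩
  rightUnitor X :=
    ⟨homMk R (Hom.rightHom X), homMk R (Hom.rightInv X),
      Quotient.sound (Rel.right_hom_inv X), Quotient.sound (Rel.right_inv_hom X)⟩

theorem whisker_exchange' {X X' Y Y' : Presented G R} (f : X ⟶ X') (g : Y ⟶ Y') :
    f ▷ Y ≫ X' ◁ g = X ◁ g ≫ f ▷ Y' := by
  obtain ⟨f⟩ := f
  obtain ⟨g⟩ := g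
  exact Quotient.sound (Rel.whisker_exchange f g)

theorem whiskerLeft_comp' (X : Presented G R) {Y Y' Y'' : Presented G R} (f : Y ⟶ Y')
    (g : Y' ⟶ Y'') : X ◁ (f ≫ g) = X ◁ f ≫ X ◁ g := by
  obtain ⟨f⟩ := f
  obtain ⟨g⟩ := g
  exact Quotient.sound (Rel.whiskerLeft_comp X f g)

theorem comp_whiskerRight' {X X' X'' : Presented G R} (f : X ⟶ X') (g : X' ⟶ X'')
    (Y : Presented G R) : (f ≫ g) ▷ Y = f ▷ Y ≫ g ▷ Y := by
  obtain ⟨f⟩ := f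
  obtain ⟨g⟩ := g
  exact Quotient.sound (Rel.comp_whiskerRight f g Y)

theorem assoc_nat_left' {X X' : Presented G R} (f : X ⟶ X') (Y Z : Presented G R) :
    (f ▷ Y) ▷ Z ≫ (α_ X' Y Z).hom = (α_ X Y Z).hom ≫ f ▷ (Y ⊗ Z) := by
  obtain ⟨f⟩ := f
  exact Quotient.sound (Rel.assoc_nat_left f Y Z)

theorem assoc_nat_middle' (X : Presented G R) {Y Y' : Presented G R} (f : Y ⟶ Y')
    (Z : Presented G R) :
    (X ◁ f) ▷ Z ≫ (α_ X Y' Z).hom = (α_ X Y Z).hom ≫ X ◁ (f ▷ Z) := by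
  obtain ⟨f⟩ := f
  exact Quotient.sound (Rel.assoc_nat_middle X f Z)

theorem assoc_nat_right' (X Y : Presented G R) {Z Z' : Presented G R} (f : Z ⟶ Z') :
    (X ⊗ Y) ◁ f ≫ (α_ X Y Z').hom = (α_ X Y Z).hom ≫ X ◁ (Y ◁ f) := by
  obtain ⟨f⟩ := f
  exact Quotient.sound (Rel.assoc_nat_right X Y f)

theorem tensorHom_eq {X X' Y Y' : Presented G R} (f : X ⟶ X') (g : Y ⟶ Y') :
    f ⊗ₘ g = f ▷ Y ≫ X' ◁ g := rfl

instance : MonoidalCategory (Presented G R) where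
  whiskerLeft_id X Y := Quotient.sound (Rel.whiskerLeft_id X Y)
  id_whiskerRight X Y := Quotient.sound (Rel.id_whiskerRight X Y)
  tensorHom_def _ _ := rfl
  id_tensorHom_id X Y := by
    rw [tensorHom_eq]
    exact Quotient.sound ((Rel.comp (Rel.id_whiskerRight X Y) (Rel.whiskerLeft_id X Y)).trans
      (Rel.id_comp _))
  tensorHom_comp_tensorHom f₁ f₂ g₁ g₂ := by
    simp only [tensorHom_eq, whiskerLeft_comp', comp_whiskerRight', Category.assoc]
    rw [← Category.assoc (_ ◁ f₂), ← whisker_exchange', Category.assoc]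
  associator_naturality f₁ f₂ f₃ := by
    simp only [tensorHom_eq, whiskerLeft_comp', comp_whiskerRight', Category.assoc,
      assoc_nat_right']
    rw [← Category.assoc _ (α_ _ _ _).hom, assoc_nat_middle', Category.assoc,
      ← Category.assoc _ (α_ _ _ _).hom, assoc_nat_left', Category.assoc]
  leftUnitor_naturality := by rintro X Y ⟨f⟩; exact Quotient.sound (Rel.left_nat f)
  rightUnitor_naturality := by rintro X Y ⟨f⟩; exact Quotient.sound (Rel.right_nat f)
  pentagon W X Y Z := Quotient.sound (Rel.pentagon W X Y Z)
  triangle X Y := Quotient.sound (Rel.triangle X Y)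

instance : SymmetricCategory (Presented G R) where
  braiding X Y :=
    ⟨homMk R (Hom.braid X Y), homMk R (Hom.braid Y X),
      Quotient.sound (Rel.braid_braid X Y), Quotient.sound (Rel.braid_braid Y X)⟩
  braiding_naturality_right := by
    rintro X Y Z ⟨f⟩; exact Quotient.sound (Rel.braid_nat_right X f)
  braiding_naturality_left := by
    rintro X Y ⟨f⟩ Z; exact Quotient.sound (Rel.braid_nat_left f Z)
  hexagon_forward X Y Z := Quotient.sound (Rel.hexagon_forward X Y Z)
  hexagon_reverse X Y Z := Quotient.sound (Rel.hexagon_reverse X Y Z)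
  symmetry X Y := Quotient.sound (Rel.braid_braid X Y)

section Eval

variable {D : Type u₁} [Category.{v₁} D] [MonoidalCategory D] [SymmetricCategory D]

/-- The value of a word in a symmetric monoidal category. -/
def evalObj (ob : L → D) : Word L → D
  | .of x => ob x
  | .unit => 𝟙_ D
  | .tensor X Y => evalObj ob X ⊗ evalObj ob Y

/-- The value of a formal morphism in a symmetric monoidal category. -/
def evalHom (ob : L → D)
    (gm : ∀ {X Y : Word L}, G X Y → (evalObj ob X ⟶ evalObj ob Y)) :
    ∀ {X Y : Word L}, Hom G X Y → (evalObj ob X ⟶ evalObj ob Y)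
  | _, _, .id _ => 𝟙 _
  | _, _, .comp f g => evalHom ob gm f ≫ evalHom ob gm g
  | _, _, .whiskerLeft X f => evalObj ob X ◁ evalHom ob gm f
  | _, _, .whiskerRight f Y => evalHom ob gm f ▷ evalObj ob Y
  | _, _, .assocHom _ _ _ => (α_ _ _ _).hom
  | _, _, .assocInv _ _ _ => (α_ _ _ _).inv
  | _, _, .leftHom _ => (λ_ _).hom
  | _, _, .leftInv _ => (λ_ _).inv
  | _, _, .rightHom _ => (ρ_ _).hom
  | _, _, .rightInv _ => (ρ_ _).inv
  | _, _, .braid _ _ => (β_ _ _).hom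
  | _, _, .gen g => gm g

theorem evalHom_rel (ob : L → D)
    (gm : ∀ {X Y : Word L}, G X Y → (evalObj ob X ⟶ evalObj ob Y))
    (hR : ∀ {X Y : Word L} (f g : Hom G X Y), R f g → evalHom ob gm f = evalHom ob gm g)
    {X Y : Word L} {f g : Hom G X Y} (h : Rel R f g) : evalHom ob gm f = evalHom ob gm g := by
  induction h with
  | of_rel h => exact hR _ _ h
  | refl => rfl
  | symm _ ih => exact ih.symm
  | trans _ _ ih ih' => exact ih.trans ih'
  | hexagon_forward X Y Z => exact BraidedCategory.hexagon_forward _ _ _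
  | hexagon_reverse X Y Z => exact BraidedCategory.hexagon_reverse _ _ _
  | pentagon => exact MonoidalCategory.pentagon _ _ _ _
  | triangle => exact MonoidalCategory.triangle _ _
  | whisker_exchange => exact (MonoidalCategory.whisker_exchange _ _).symm
  | braid_nat_left => exact BraidedCategory.braiding_naturality_left _ _
  | braid_nat_right => exact BraidedCategory.braiding_naturality_right _ _
  | _ => simp_all [evalHom, evalObj]

/-- The strict symmetric monoidal functor out of a presented symmetric monoidal category
determined by values on the generators that respect the relations. -/
def eval (ob : L → D) (gm : ∀ {X Y : Word L}, G X Y → (evalObj ob X ⟶ evalObj ob Y))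
    (hR : ∀ {X Y : Word L} (f g : Hom G X Y), R f g → evalHom ob gm f = evalHom ob gm g) :
    Presented G R ⥤ D where
  obj := evalObj ob
  map {X Y} := Quotient.lift (evalHom ob gm (X := X) (Y := Y))
    (fun _ _ h => evalHom_rel ob gm hR h)
  map_id _ := rfl
  map_comp := by rintro X Y Z ⟨f⟩ ⟨g⟩; rfl

end Eval

section Perm

/-- The set of letter occurrences in a word, when the letter `x` itself stands for an expression
with set of letter occurrences `p x`. Formal units contribute nothing. -/
def Word.Pos (p : L → Type) : Word L → Type
  | .of x => p x
  | .unit => Empty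
  | .tensor X Y => Word.Pos p X ⊕ Word.Pos p Y

/-- The bijection between letter occurrences induced by a formal morphism. -/
def Hom.perm (p : L → Type) (gp : ∀ {X Y : Word L}, G X Y → (X.Pos p ≃ Y.Pos p)) :
    ∀ {X Y : Word L}, Hom G X Y → (X.Pos p ≃ Y.Pos p)
  | _, _, .id _ => Equiv.refl _
  | _, _, .comp f g => (Hom.perm p gp f).trans (Hom.perm p gp g)
  | _, _, .whiskerLeft _ f => Equiv.sumCongr (Equiv.refl _) (Hom.perm p gp f)
  | _, _, .whiskerRight f _ => Equiv.sumCongr (Hom.perm p gp f) (Equiv.refl _)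
  | _, _, .assocHom _ _ _ => Equiv.sumAssoc _ _ _
  | _, _, .assocInv _ _ _ => (Equiv.sumAssoc _ _ _).symm
  | _, _, .leftHom _ => Equiv.emptySum Empty _
  | _, _, .leftInv _ => (Equiv.emptySum Empty _).symm
  | _, _, .rightHom _ => Equiv.sumEmpty _ Empty
  | _, _, .rightInv _ => (Equiv.sumEmpty _ Empty).symm
  | _, _, .braid _ _ => Equiv.sumComm _ _
  | _, _, .gen g => gp g

theorem Hom.perm_rel (p : L → Type) (gp : ∀ {X Y : Word L}, G X Y → (X.Pos p ≃ Y.Pos p))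
    (hR : ∀ {X Y : Word L} (f g : Hom G X Y), R f g → f.perm p gp = g.perm p gp)
    {X Y : Word L} {f g : Hom G X Y} (h : Rel R f g) : f.perm p gp = g.perm p gp := by
  induction h with
  | of_rel h => exact hR _ _ h
  | refl => rfl
  | symm _ ih => exact ih.symm
  | trans _ _ ih ih' => exact ih.trans ih'
  | comp _ _ ih ih' => exact congrArg₂ Equiv.trans ih ih'
  | whiskerLeft _ _ ih => exact congrArg (Equiv.sumCongr (Equiv.refl _)) ih
  | whiskerRight _ _ ih => exact congrArg (fun e => Equiv.sumCongr e (Equiv.refl _)) ih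
  | pentagon => ext x; rcases x with ((x | x) | x) | x <;> rfl
  | hexagon_forward => ext x; rcases x with (x | x) | x <;> rfl
  | hexagon_reverse => ext x; rcases x with x | (x | x) <;> rfl
  | triangle => ext x; rcases x with (x | x) | x <;> first | rfl | exact x.elim
  | assoc_nat_left => ext x; rcases x with (x | x) | x <;> rfl
  | assoc_nat_middle => ext x; rcases x with (x | x) | x <;> rfl
  | assoc_nat_right => ext x; rcases x with (x | x) | x <;> rfl
  | assoc_hom_inv => ext x; rcases x with (x | x) | x <;> rfl
  | assoc_inv_hom => ext x; rcases x with x | (x | x) <;> rfl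
  | left_inv_hom => rfl
  | right_inv_hom => rfl
  | id_comp => rfl
  | comp_id => rfl
  | assoc => rfl
  | _ => ext x; rcases x with x | x <;> first | rfl | exact x.elim

/-- The bijection between letter occurrences induced by a morphism of a presented symmetric
monoidal category. -/
def permOf (p : L → Type) (gp : ∀ {X Y : Word L}, G X Y → (X.Pos p ≃ Y.Pos p))
    (hR : ∀ {X Y : Word L} (f g : Hom G X Y), R f g → f.perm p gp = g.perm p gp)
    {X Y : Presented G R} : (X ⟶ Y) → (Word.Pos p X ≃ Word.Pos p Y) :=
  Quotient.lift (Hom.perm p gp) (fun _ _ h => Hom.perm_rel p gp hR h)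

end Perm

end Presented

/-! ### The free symmetric monoidal category on a set -/

/-- The free symmetric monoidal category on `T`: no further generators, no further relations. -/
abbrev FreeSym (T : Type u) : Type u :=
  Presented (L := T) (fun _ _ => PEmpty.{u + 1}) (fun {_ _} _ _ => False)

/-- The set of letter occurrences in an object of the free symmetric monoidal category. -/
abbrev FreeSym.Pos {T : Type u} (W : FreeSym T) : Type :=
  Word.Pos (fun _ : T => Unit) W

/-- The underlying permutation of a morphism of the free symmetric monoidal category. -/
def FreeSym.perm {T : Type u} {W W' : FreeSym T} (f : W ⟶ W') : W.Pos ≃ W'.Pos :=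
  permOf (fun _ => Unit) (fun g => g.elim) (fun _ _ h => h.elim) f

/-- The canonical strict symmetric monoidal functor to `C` from the free symmetric monoidal
category on the objects of `C`. -/
def FreeSym.toCat (C : Type u) [Category.{v} C] [MonoidalCategory C] [SymmetricCategory C] :
    FreeSym C ⥤ C :=
  eval (fun X => X) (fun g => g.elim) (fun _ _ h => h.elim)

/-! ### The free normal lax symmetric monoidal functor on a set -/

/-- Generating morphisms of the target of the free normal lax symmetric monoidal functor `Φ` on
`T`. The letter `W` stands for `Φ(W)`: the generators are the images `Φ(f)`, the composition maps
`Φ(W) ⊗ Φ(W') ⟶ Φ(W ⊗ W')`, the unit map `I ⟶ Φ(I)` and a formal inverse of it. -/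
inductive LaxGen (T : Type u) : Word (FreeSym T) → Word (FreeSym T) → Type u
  | map {W W' : FreeSym T} (f : W ⟶ W') : LaxGen T (.of W) (.of W')
  | mu (W W' : FreeSym T) : LaxGen T ((Word.of W).tensor (.of W')) (.of (W ⊗ W'))
  | eps : LaxGen T .unit (.of (𝟙_ (FreeSym T)))
  | epsInv : LaxGen T (.of (𝟙_ (FreeSym T))) .unit

/-- The axioms of a normal lax symmetric monoidal functor, as relations between formal morphisms
in the target. -/
inductive LaxRel (T : Type u) :
    ∀ {X Y : Word (FreeSym T)}, Hom (LaxGen T) X Y → Hom (LaxGen T) X Y → Prop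
  | map_id (W : FreeSym T) : LaxRel T (.gen (.map (𝟙 W))) (.id _)
  | map_comp {W W' W'' : FreeSym T} (f : W ⟶ W') (g : W' ⟶ W'') :
      LaxRel T (.gen (.map (f ≫ g))) (.comp (.gen (.map f)) (.gen (.map g)))
  | eps_epsInv : LaxRel T (.comp (.gen .eps) (.gen .epsInv)) (.id _)
  | epsInv_eps : LaxRel T (.comp (.gen .epsInv) (.gen .eps)) (.id _)
  | mu_nat_left {W W' : FreeSym T} (f : W ⟶ W') (V : FreeSym T) :
      LaxRel T (.comp (.whiskerRight (.gen (.map f)) (.of V)) (.gen (.mu W' V)))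
        (.comp (.gen (.mu W V)) (.gen (.map (f ▷ V))))
  | mu_nat_right {W W' : FreeSym T} (V : FreeSym T) (f : W ⟶ W') :
      LaxRel T (.comp (.whiskerLeft (.of V) (.gen (.map f))) (.gen (.mu V W')))
        (.comp (.gen (.mu V W)) (.gen (.map (V ◁ f))))
  | associativity (W₁ W₂ W₃ : FreeSym T) :
      LaxRel T
        (.comp (.whiskerRight (.gen (.mu W₁ W₂)) (.of W₃))
          (.comp (.gen (.mu (W₁ ⊗ W₂) W₃)) (.gen (.map (α_ W₁ W₂ W₃).hom))))
        (.comp (.assocHom (.of W₁) (.of W₂) (.of W₃))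
          (.comp (.whiskerLeft (.of W₁) (.gen (.mu W₂ W₃))) (.gen (.mu W₁ (W₂ ⊗ W₃)))))
  | left_unitality (W : FreeSym T) :
      LaxRel T (.leftHom (.of W))
        (.comp (.whiskerRight (.gen .eps) (.of W))
          (.comp (.gen (.mu (𝟙_ (FreeSym T)) W)) (.gen (.map (λ_ W).hom))))
  | right_unitality (W : FreeSym T) :
      LaxRel T (.rightHom (.of W))
        (.comp (.whiskerLeft (.of W) (.gen .eps))
          (.comp (.gen (.mu W (𝟙_ (FreeSym T)))) (.gen (.map (ρ_ W).hom))))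
  | braided (W W' : FreeSym T) :
      LaxRel T (.comp (.gen (.mu W W')) (.gen (.map (β_ W W').hom)))
        (.comp (.braid (.of W) (.of W')) (.gen (.mu W' W)))

/-- The target of the free normal lax symmetric monoidal functor on `T`. Its objects are
parenthesized words in formal units and terms `Φ(W)` with `W` an object of `FreeSym T`. -/
abbrev FreeLax (T : Type u) : Type u := Presented (LaxGen T) (LaxRel T)

namespace FreeLax

/-- The free normal lax symmetric monoidal functor on `T`. -/
def functor (T : Type u) : FreeSym T ⥤ FreeLax T where
  obj W := Word.of W
  map f := homMk _ (.gen (.map f))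
  map_id W := Quotient.sound (.of_rel (.map_id W))
  map_comp f g := Quotient.sound (.of_rel (.map_comp f g))

instance (T : Type u) : (functor T).LaxBraided where
  ε := homMk _ (.gen .eps)
  μ W W' := homMk _ (.gen (.mu W W'))
  μ_natural_left f V := Quotient.sound (.of_rel (.mu_nat_left f V))
  μ_natural_right V f := Quotient.sound (.of_rel (.mu_nat_right V f))
  associativity W₁ W₂ W₃ := Quotient.sound (.of_rel (.associativity W₁ W₂ W₃))
  left_unitality W := Quotient.sound (.of_rel (.left_unitality W))
  right_unitality W := Quotient.sound (.of_rel (.right_unitality W))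
  braided W W' := Quotient.sound (.of_rel (.braided W W'))

instance (T : Type u) : IsIso (Functor.LaxMonoidal.ε (functor T)) :=
  ⟨homMk _ (.gen .epsInv), Quotient.sound (.of_rel .eps_epsInv),
    Quotient.sound (.of_rel .epsInv_eps)⟩

/-- The set of occurrences of letters of `T` in an object of `FreeLax T`. -/
abbrev Pos {T : Type u} (X : FreeLax T) : Type :=
  Word.Pos (fun W : FreeSym T => W.Pos) X

/-- The effect of a generator on letter occurrences: `Φ(f)` permutes letters as `f` does, all
other generators leave the letters in place. -/
def genPerm {T : Type u} : ∀ {X Y : Word (FreeSym T)}, LaxGen T X Y →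
    (X.Pos (fun W : FreeSym T => W.Pos) ≃ Y.Pos (fun W : FreeSym T => W.Pos))
  | _, _, .map f => FreeSym.perm f
  | _, _, .mu _ _ => Equiv.refl _
  | _, _, .eps => Equiv.refl _
  | _, _, .epsInv => Equiv.refl _

theorem genPerm_rel {T : Type u} {X Y : Word (FreeSym T)} (f g : Hom (LaxGen T) X Y)
    (h : LaxRel T f g) :
    f.perm (fun W : FreeSym T => W.Pos) genPerm = g.perm (fun W : FreeSym T => W.Pos) genPerm := by
  cases h with
  | map_id => rfl
  | map_comp f g => obtain ⟨f⟩ := f; obtain ⟨g⟩ := g; rfl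
  | eps_epsInv => rfl
  | epsInv_eps => rfl
  | mu_nat_left f => obtain ⟨f⟩ := f; rfl
  | mu_nat_right _ f => obtain ⟨f⟩ := f; rfl
  | associativity => ext x; rcases x with (x | x) | x <;> rfl
  | left_unitality => ext x; rcases x with x | x <;> rfl
  | right_unitality => ext x; rcases x with x | x <;> rfl
  | braided => rfl

/-- The underlying permutation of a morphism of `FreeLax T`, as a bijection between the letter
occurrences of its source and of its target. Numbering letter occurrences from left to right
turns it into an element of the symmetric group. -/
def perm {T : Type u} {X Y : FreeLax T} (φ : X ⟶ Y) : X.Pos ≃ Y.Pos :=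
  permOf (fun W : FreeSym T => W.Pos) genPerm genPerm_rel φ

section

open Functor.LaxMonoidal

variable {C : Type u} [Category.{v} C] [MonoidalCategory C] [SymmetricCategory C]
  {D : Type u₁} [Category.{v₁} D] [MonoidalCategory D] [SymmetricCategory D]
  (F : C ⥤ D) [F.LaxBraided] [IsIso (ε F)]

/-- The value in `D` of a term `Φ(W)`. -/
abbrev toCatOb (W : FreeSym C) : D := F.obj ((FreeSym.toCat C).obj W)

/-- The value in `D` of a generating morphism. -/
noncomputable def toCatGen : ∀ {X Y : Word (FreeSym C)}, LaxGen C X Y →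
    (evalObj (toCatOb F) X ⟶ evalObj (toCatOb F) Y)
  | _, _, .map f => F.map ((FreeSym.toCat C).map f)
  | _, _, .mu W W' => μ F ((FreeSym.toCat C).obj W) ((FreeSym.toCat C).obj W')
  | _, _, .eps => ε F
  | _, _, .epsInv => (asIso (ε F)).inv

theorem toCatGen_rel {X Y : Word (FreeSym C)} (f g : Hom (LaxGen C) X Y) (h : LaxRel C f g) :
    evalHom (toCatOb F) (toCatGen F) f = evalHom (toCatOb F) (toCatGen F) g := by
  cases h with
  | map_id W => exact (congrArg F.map ((FreeSym.toCat C).map_id W)).trans (F.map_id _)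
  | map_comp f g => exact (congrArg F.map ((FreeSym.toCat C).map_comp f g)).trans (F.map_comp _ _)
  | eps_epsInv => exact (asIso (ε F)).hom_inv_id
  | epsInv_eps => exact (asIso (ε F)).inv_hom_id
  | mu_nat_left f V => obtain ⟨f⟩ := f; exact μ_natural_left F _ _
  | mu_nat_right V f => obtain ⟨f⟩ := f; exact μ_natural_right F _ _
  | associativity => exact associativity F _ _ _
  | left_unitality => exact left_unitality F _
  | right_unitality => exact right_unitality F _
  | braided => exact Functor.LaxBraided.braided _ _

/-- The canonical strict symmetric monoidal functor to `D` from the target of the free normal lax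
symmetric monoidal functor on the objects of `C`, for a normal lax symmetric monoidal functor
`F : C ⥤ D`: it sends `Φ(W)` to `F` applied to the value of `W` in `C`. -/
noncomputable def toCat : FreeLax C ⥤ D :=
  eval (toCatOb F) (toCatGen F) (toCatGen_rel F)

theorem functor_comp_toCat : functor C ⋙ toCat F = FreeSym.toCat C ⋙ F := rfl

end

end FreeLax

/-! ### The free normal oplax symmetric monoidal functor on a set -/

/-- An oplax monoidal functor between symmetric monoidal categories is oplax symmetric monoidal
if it is compatible with the symmetries. -/
class OplaxSymmetric {C : Type u} [Category.{v} C] [MonoidalCategory C] [SymmetricCategory C]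
    {D : Type u₁} [Category.{v₁} D] [MonoidalCategory D] [SymmetricCategory D]
    (F : C ⥤ D) extends F.OplaxMonoidal where
  braided (X Y : C) : F.map (β_ X Y).hom ≫ δ Y X = δ X Y ≫ (β_ (F.obj X) (F.obj Y)).hom

/-- Generating morphisms of the target of the free normal oplax symmetric monoidal functor `Φ` on
`T`. The letter `W` stands for `Φ(W)`: the generators are the images `Φ(f)`, the maps
`Φ(W ⊗ W') ⟶ Φ(W) ⊗ Φ(W')`, the counit map `Φ(I) ⟶ I` and a formal inverse of it. -/
inductive OplaxGen (T : Type u) : Word (FreeSym T) → Word (FreeSym T) → Type u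
  | map {W W' : FreeSym T} (f : W ⟶ W') : OplaxGen T (.of W) (.of W')
  | delta (W W' : FreeSym T) : OplaxGen T (.of (W ⊗ W')) ((Word.of W).tensor (.of W'))
  | eta : OplaxGen T (.of (𝟙_ (FreeSym T))) .unit
  | etaInv : OplaxGen T .unit (.of (𝟙_ (FreeSym T)))

/-- The axioms of a normal oplax symmetric monoidal functor, as relations between formal morphisms
in the target. -/
inductive OplaxRel (T : Type u) :
    ∀ {X Y : Word (FreeSym T)}, Hom (OplaxGen T) X Y → Hom (OplaxGen T) X Y → Prop
  | map_id (W : FreeSym T) : OplaxRel T (.gen (.map (𝟙 W))) (.id _)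
  | map_comp {W W' W'' : FreeSym T} (f : W ⟶ W') (g : W' ⟶ W'') :
      OplaxRel T (.gen (.map (f ≫ g))) (.comp (.gen (.map f)) (.gen (.map g)))
  | eta_etaInv : OplaxRel T (.comp (.gen .eta) (.gen .etaInv)) (.id _)
  | etaInv_eta : OplaxRel T (.comp (.gen .etaInv) (.gen .eta)) (.id _)
  | delta_nat_left {W W' : FreeSym T} (f : W ⟶ W') (V : FreeSym T) :
      OplaxRel T (.comp (.gen (.delta W V)) (.whiskerRight (.gen (.map f)) (.of V)))
        (.comp (.gen (.map (f ▷ V))) (.gen (.delta W' V)))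
  | delta_nat_right {W W' : FreeSym T} (V : FreeSym T) (f : W ⟶ W') :
      OplaxRel T (.comp (.gen (.delta V W)) (.whiskerLeft (.of V) (.gen (.map f))))
        (.comp (.gen (.map (V ◁ f))) (.gen (.delta V W')))
  | associativity (W₁ W₂ W₃ : FreeSym T) :
      OplaxRel T
        (.comp (.gen (.delta (W₁ ⊗ W₂) W₃))
          (.comp (.whiskerRight (.gen (.delta W₁ W₂)) (.of W₃))
            (.assocHom (.of W₁) (.of W₂) (.of W₃))))
        (.comp (.gen (.map (α_ W₁ W₂ W₃).hom))
          (.comp (.gen (.delta W₁ (W₂ ⊗ W₃))) (.whiskerLeft (.of W₁) (.gen (.delta W₂ W₃)))))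
  | left_unitality (W : FreeSym T) :
      OplaxRel T (.leftInv (.of W))
        (.comp (.gen (.map (λ_ W).inv))
          (.comp (.gen (.delta (𝟙_ (FreeSym T)) W)) (.whiskerRight (.gen .eta) (.of W))))
  | right_unitality (W : FreeSym T) :
      OplaxRel T (.rightInv (.of W))
        (.comp (.gen (.map (ρ_ W).inv))
          (.comp (.gen (.delta W (𝟙_ (FreeSym T)))) (.whiskerLeft (.of W) (.gen .eta))))
  | braided (W W' : FreeSym T) :
      OplaxRel T (.comp (.gen (.map (β_ W W').hom)) (.gen (.delta W' W)))
        (.comp (.gen (.delta W W')) (.braid (.of W) (.of W')))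

/-- The target of the free normal oplax symmetric monoidal functor on `T`. Its objects are
parenthesized words in formal units and terms `Φ(W)` with `W` an object of `FreeSym T`. -/
abbrev FreeOplax (T : Type u) : Type u := Presented (OplaxGen T) (OplaxRel T)

namespace FreeOplax

/-- The free normal oplax symmetric monoidal functor on `T`. -/
def functor (T : Type u) : FreeSym T ⥤ FreeOplax T where
  obj W := Word.of W
  map f := homMk _ (.gen (.map f))
  map_id W := Quotient.sound (.of_rel (.map_id W))
  map_comp f g := Quotient.sound (.of_rel (.map_comp f g))

instance (T : Type u) : OplaxSymmetric (functor T) where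
  η := homMk _ (.gen .eta)
  δ W W' := homMk _ (.gen (.delta W W'))
  δ_natural_left f V := Quotient.sound (.of_rel (.delta_nat_left f V))
  δ_natural_right V f := Quotient.sound (.of_rel (.delta_nat_right V f))
  oplax_associativity W₁ W₂ W₃ := Quotient.sound (.of_rel (.associativity W₁ W₂ W₃))
  oplax_left_unitality W := Quotient.sound (.of_rel (.left_unitality W))
  oplax_right_unitality W := Quotient.sound (.of_rel (.right_unitality W))
  braided W W' := Quotient.sound (.of_rel (.braided W W'))

instance (T : Type u) : IsIso (Functor.OplaxMonoidal.η (functor T)) :=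
  ⟨homMk _ (.gen .etaInv), Quotient.sound (.of_rel .eta_etaInv),
    Quotient.sound (.of_rel .etaInv_eta)⟩

/-- The set of occurrences of letters of `T` in an object of `FreeOplax T`. -/
abbrev Pos {T : Type u} (X : FreeOplax T) : Type :=
  Word.Pos (fun W : FreeSym T => W.Pos) X

/-- The effect of a generator on letter occurrences: `Φ(f)` permutes letters as `f` does, all
other generators leave the letters in place. -/
def genPerm {T : Type u} : ∀ {X Y : Word (FreeSym T)}, OplaxGen T X Y →
    (X.Pos (fun W : FreeSym T => W.Pos) ≃ Y.Pos (fun W : FreeSym T => W.Pos))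
  | _, _, .map f => FreeSym.perm f
  | _, _, .delta _ _ => Equiv.refl _
  | _, _, .eta => Equiv.refl _
  | _, _, .etaInv => Equiv.refl _

theorem genPerm_rel {T : Type u} {X Y : Word (FreeSym T)} (f g : Hom (OplaxGen T) X Y)
    (h : OplaxRel T f g) :
    f.perm (fun W : FreeSym T => W.Pos) genPerm = g.perm (fun W : FreeSym T => W.Pos) genPerm := by
  cases h with
  | map_id => rfl
  | map_comp f g => obtain ⟨f⟩ := f; obtain ⟨g⟩ := g; rfl
  | eta_etaInv => rfl
  | etaInv_eta => rfl
  | delta_nat_left f => obtain ⟨f⟩ := f; rfl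
  | delta_nat_right _ f => obtain ⟨f⟩ := f; rfl
  | associativity => ext x; rcases x with (x | x) | x <;> rfl
  | left_unitality => ext x; rfl
  | right_unitality => ext x; rfl
  | braided => rfl

/-- The underlying permutation of a morphism of `FreeOplax T`, as a bijection between the letter
occurrences of its source and of its target. -/
def perm {T : Type u} {X Y : FreeOplax T} (φ : X ⟶ Y) : X.Pos ≃ Y.Pos :=
  permOf (fun W : FreeSym T => W.Pos) genPerm genPerm_rel φ

section

open Functor.OplaxMonoidal

variable {C : Type u} [Category.{v} C] [MonoidalCategory C] [SymmetricCategory C]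
  {D : Type u₁} [Category.{v₁} D] [MonoidalCategory D] [SymmetricCategory D]
  (F : C ⥤ D) [OplaxSymmetric F] [IsIso (η F)]

/-- The value in `D` of a term `Φ(W)`. -/
abbrev toCatOb (W : FreeSym C) : D := F.obj ((FreeSym.toCat C).obj W)

/-- The value in `D` of a generating morphism. -/
noncomputable def toCatGen : ∀ {X Y : Word (FreeSym C)}, OplaxGen C X Y →
    (evalObj (toCatOb F) X ⟶ evalObj (toCatOb F) Y)
  | _, _, .map f => F.map ((FreeSym.toCat C).map f)
  | _, _, .delta W W' => δ F ((FreeSym.toCat C).obj W) ((FreeSym.toCat C).obj W')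
  | _, _, .eta => η F
  | _, _, .etaInv => (asIso (η F)).inv

theorem toCatGen_rel {X Y : Word (FreeSym C)} (f g : Hom (OplaxGen C) X Y) (h : OplaxRel C f g) :
    evalHom (toCatOb F) (toCatGen F) f = evalHom (toCatOb F) (toCatGen F) g := by
  cases h with
  | map_id W => exact (congrArg F.map ((FreeSym.toCat C).map_id W)).trans (F.map_id _)
  | map_comp f g => exact (congrArg F.map ((FreeSym.toCat C).map_comp f g)).trans (F.map_comp _ _)
  | eta_etaInv => exact (asIso (η F)).hom_inv_id
  | etaInv_eta => exact (asIso (η F)).inv_hom_id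
  | delta_nat_left f V => obtain ⟨f⟩ := f; exact δ_natural_left F _ _
  | delta_nat_right V f => obtain ⟨f⟩ := f; exact δ_natural_right F _ _
  | associativity => exact oplax_associativity F _ _ _
  | left_unitality => exact oplax_left_unitality F _
  | right_unitality => exact oplax_right_unitality F _
  | braided => exact OplaxSymmetric.braided _ _

/-- The canonical strict symmetric monoidal functor to `D` from the target of the free normal
oplax symmetric monoidal functor on the objects of `C`, for a normal oplax symmetric monoidal
functor `F : C ⥤ D`. -/
noncomputable def toCat : FreeOplax C ⥤ D :=
  eval (toCatOb F) (toCatGen F) (toCatGen_rel F)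

theorem functor_comp_toCat : functor C ⋙ toCat F = FreeSym.toCat C ⋙ F := rfl

end

end FreeOplax

/-! ### Formal diagrams -/

/-- A diagram commutes if parallel composites in it are equal. -/
def Commutes {J : Type u} [Category.{v} J] {D : Type u₁} [Category.{v₁} D] (Δ : J ⥤ D) : Prop :=
  ∀ ⦃a b : J⦄ (f g : a ⟶ b), Δ.map f = Δ.map g

section

variable {C : Type u} [Category.{v} C] [MonoidalCategory C] [SymmetricCategory C]
  {D : Type u₁} [Category.{v₁} D] [MonoidalCategory D] [SymmetricCategory D]
  {J : Type w} [Category.{w'} J]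

/-- A diagram in `D` is formal for the normal lax symmetric monoidal functor `F : C ⥤ D` and is
expected to commute if it has a lift to `FreeLax C` in which parallel composites have the same
underlying permutation. -/
def LaxExpectedToCommute (F : C ⥤ D) [F.LaxBraided] [IsIso (Functor.LaxMonoidal.ε F)]
    (Δ : J ⥤ D) : Prop :=
  ∃ K : J ⥤ FreeLax C, K ⋙ FreeLax.toCat F = Δ ∧
    ∀ ⦃a b : J⦄ (f g : a ⟶ b), FreeLax.perm (K.map f) = FreeLax.perm (K.map g)

/-- The same condition for a normal oplax symmetric monoidal functor. -/
def OplaxExpectedToCommute (F : C ⥤ D) [OplaxSymmetric F] [IsIso (Functor.OplaxMonoidal.η F)]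
    (Δ : J ⥤ D) : Prop :=
  ∃ K : J ⥤ FreeOplax C, K ⋙ FreeOplax.toCat F = Δ ∧
    ∀ ⦃a b : J⦄ (f g : a ⟶ b), FreeOplax.perm (K.map f) = FreeOplax.perm (K.map g)

end

/-! ### The localized comma category of finite sets -/

/-- The injective order-preserving maps in the category `n ↓ Fin` of finite sets
`{1, …, k}` under `{1, …, n}`. -/
def injMono (n : ℕ) : MorphismProperty (Under (FintypeCat.Skeleton.mk.{0} n)) :=
  fun X Y f => ∃ φ : Fin X.right.len → Fin Y.right.len,
    StrictMono φ ∧ ∀ i, f.right ⟨i⟩ = ⟨φ i⟩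

end SymCoh

/-! Fix the source `X` of a formal morphism and let `ι` be its set of letter occurrences. For each
word `Y` and each labelling of the occurrences of `Y` by `ι` there is at most one "canonical" map in
`D` to the value of `Y`, from an object that depends only on the set of labels used. All structure
maps, hence the values of all formal morphisms, carry canonical maps to canonical maps and relabel
them by the underlying permutation (`preserves_evalHom`). The identity labelling of `X` has an
invertible canonical map `c` (`admits_outerCanon`). If `f` and `g` have the same permutation, then
`c ≫ f` and `c ≫ g` are canonical for the same labelling, so they agree (`unique_outerCanon`), and
`c` cancels. No normal form for words or morphisms is needed.

The sources of canonical maps form two tensor systems. In `C`, `N K` is the tensor product of the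
letters in `K ⊆ ι`, arranged as in `X`, and every disjoint union `K = a ∪ b` gives `N a ⊗ N b ≅ N
K`. In `D`, `M K` is the tensor product over the terms `Φ(W)` of `X` of `F` applied to the part of
`K` in `W`. As `μ` need not be invertible, `M K` is split only along unions in which no term of `X`
meets both parts; the relation `r` of a system records which occurrences must stay together. This
suffices because lax structure maps merge terms and detach at most units. Normality makes `F (N ∅)`
a unit, so terms not meeting `K` can be discarded. A `Transfer` `M K ⟶ F (N K)` multiplies the
pieces by `μ`, and canonical maps to `Φ(W)` are this transfer followed by `F` of a canonical map in
`C`.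

The oplax case runs the same argument for `F.op`, starting from the target of the formal morphism.
For the localization, taking the image of `{1, …, n}` is a functor to the thin category of
surjections, and the image inclusions are natural and get inverted. -/

namespace SymCoh

/-! ### Tensor systems: coherent tensor products indexed by subsets. -/

section TensorSystem

variable {V : Type u} [Category.{v} V] [MonoidalCategory V] [SymmetricCategory V]

/-- `s` is the union of `a` and `b`, and no element of `a` is related to an element of `b`. -/
structure Split {ι : Type} (r : ι → ι → Prop) (s a b : Set ι) : Prop where
  eq_union : s = a ∪ b
  not_rel : ∀ i ∈ a, ∀ j ∈ b, ¬ r i j ∧ ¬ r j i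

namespace Split

variable {ι κ : Type} {r : ι → ι → Prop} {s a b c d e : Set ι}

theorem symm (h : Split r s a b) : Split r s b a :=
  ⟨h.eq_union.trans (Set.union_comm a b), fun i hi j hj => (h.not_rel j hj i hi).symm⟩

theorem empty_left (r : ι → ι → Prop) (a : Set ι) : Split r a ∅ a :=
  ⟨(Set.empty_union a).symm, fun _ hi => hi.elim⟩

theorem eq_of_empty_left (h : Split r s ∅ b) : s = b := by
  simpa using h.eq_union

theorem eq_of_empty_right (h : Split r s a ∅) : s = a := by
  simpa using h.eq_union

theorem empty_or_empty (h : Split (fun _ _ => True) s a b) : a = ∅ ∨ b = ∅ := by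
  by_contra! hab
  obtain ⟨⟨i, hi⟩, ⟨j, hj⟩⟩ := hab
  exact (h.not_rel i hi j hj).1 trivial

theorem mono {r' : ι → ι → Prop} (hr : ∀ i j, r' i j → r i j) (h : Split r s a b) :
    Split r' s a b :=
  ⟨h.eq_union, fun i hi j hj =>
    ⟨fun hij => (h.not_rel i hi j hj).1 (hr _ _ hij),
      fun hij => (h.not_rel i hi j hj).2 (hr _ _ hij)⟩⟩

theorem preimage {r' : κ → κ → Prop} (f : κ → ι) (hr : ∀ i j, r' i j → r (f i) (f j))
    (h : Split r s a b) : Split r' (f ⁻¹' s) (f ⁻¹' a) (f ⁻¹' b) :=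
  ⟨by rw [h.eq_union, Set.preimage_union], fun i hi j hj =>
    ⟨fun hij => (h.not_rel _ hi _ hj).1 (hr _ _ hij),
      fun hij => (h.not_rel _ hi _ hj).2 (hr _ _ hij)⟩⟩

/-- Supplies the two splittings for the other bracketing, which `mul_assoc` takes as separate
arguments. -/
theorem assoc (h : Split r s d c) (h' : Split r d a b) :
    Split r s a (b ∪ c) ∧ Split r (b ∪ c) b c := by
  obtain ⟨rfl, h⟩ := h
  obtain ⟨rfl, h'⟩ := h'
  refine ⟨⟨Set.union_assoc a b c, ?_⟩, ⟨rfl, fun i hi j hj => h i (.inr hi) j hj⟩⟩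
  rintro i hi j (hj | hj)
  exacts [h' i hi j hj, h i (.inl hi) j hj]

theorem assoc_symm (h : Split r s a e) (h' : Split r e b c) :
    Split r s (a ∪ b) c ∧ Split r (a ∪ b) a b := by
  obtain ⟨rfl, h⟩ := h
  obtain ⟨rfl, h'⟩ := h'
  refine ⟨⟨(Set.union_assoc a b c).symm, ?_⟩, ⟨rfl, fun i hi j hj => h i hi j (.inl hj)⟩⟩
  rintro i (hi | hi) j hj
  exacts [h i hi j (.inr hj), h' i hi j hj]

end Split

/-- Objects indexed by subsets of `ι`, together with coherent isomorphisms turning the union of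
two subsets with unrelated elements into a tensor product. -/
structure TensorSystem (V : Type u) [Category.{v} V] [MonoidalCategory V] [SymmetricCategory V]
    {ι : Type} (r : ι → ι → Prop) where
  obj : Set ι → V
  unit : 𝟙_ V ≅ obj ∅
  mul {s a b : Set ι} (h : Split r s a b) : obj a ⊗ obj b ≅ obj s
  unit_mul {a : Set ι} (h : Split r a ∅ a) :
    unit.hom ▷ obj a ≫ (mul h).hom = (λ_ (obj a)).hom
  mul_comm {s a b : Set ι} (h : Split r s a b) :
    (β_ (obj a) (obj b)).hom ≫ (mul h.symm).hom = (mul h).hom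
  mul_assoc {s d e a b c : Set ι} (h : Split r s d c) (h' : Split r d a b)
    (k : Split r s a e) (k' : Split r e b c) :
    (mul h').hom ▷ obj c ≫ (mul h).hom =
      (α_ (obj a) (obj b) (obj c)).hom ≫ obj a ◁ (mul k').hom ≫ (mul k).hom

namespace TensorSystem

section Point

variable {ι : Type} (N : Set ι → V) (u : 𝟙_ V ≅ N ∅)

open Classical in
/-- The multiplication when all elements are related, so that one factor is indexed by `∅`. -/
noncomputable def pointMul {s a b : Set ι} (h : Split (fun _ _ => True) s a b) :
    N a ⊗ N b ≅ N s :=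
  if ha : a = ∅ then
    whiskerRightIso (eqToIso (congrArg N ha) ≪≫ u.symm) (N b) ≪≫ λ_ (N b) ≪≫
      eqToIso (congrArg N (by subst ha; exact h.eq_of_empty_left.symm))
  else
    have hb : b = ∅ := h.empty_or_empty.resolve_left ha
    whiskerLeftIso (N a) (eqToIso (congrArg N hb) ≪≫ u.symm) ≪≫ ρ_ (N a) ≪≫
      eqToIso (congrArg N (by subst hb; exact h.eq_of_empty_right.symm))

omit [SymmetricCategory V] in
theorem pointMul_empty_left {a : Set ι} (h : Split (fun _ _ => True) a ∅ a) :
    (pointMul N u h).hom = u.inv ▷ N a ≫ (λ_ (N a)).hom := by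
  simp [pointMul]

omit [SymmetricCategory V] in
theorem pointMul_empty_right {a : Set ι} (h : Split (fun _ _ => True) a a ∅) :
    (pointMul N u h).hom = N a ◁ u.inv ≫ (ρ_ (N a)).hom := by
  -- When both blocks are empty, `pointMul` uses its first branch; the two formulas agree because
  -- the left and right unitors of the unit object coincide.
  by_cases ha : a = ∅
  · subst ha
    rw [pointMul_empty_left, ← cancel_epi (u.hom ▷ _), ← cancel_epi (𝟙_ V ◁ u.hom)]
    simp [← whisker_exchange_assoc, ← unitors_equal]
  · simp [pointMul, ha]

/-- A system in which all elements are related is given by arbitrary objects, with the unit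
object for the empty set. -/
noncomputable def point : TensorSystem V (fun _ _ : ι => True) where
  obj := N
  unit := u
  mul h := pointMul N u h
  unit_mul h := by simp [pointMul_empty_left]
  mul_comm {s a b} h := by
    rcases h.empty_or_empty with rfl | rfl
    · obtain rfl := h.eq_of_empty_left
      rw [pointMul_empty_left, pointMul_empty_right, ← BraidedCategory.braiding_naturality_left_assoc,
        braiding_rightUnitor]
    · obtain rfl := h.eq_of_empty_right
      rw [pointMul_empty_left, pointMul_empty_right,
        ← BraidedCategory.braiding_naturality_right_assoc, braiding_leftUnitor]
  mul_assoc {s d e a b c} h h' k k' := by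
    rcases h'.empty_or_empty with rfl | rfl
    · obtain rfl := h'.eq_of_empty_left
      obtain rfl := k.eq_of_empty_left
      rw [pointMul_empty_left, pointMul_empty_left, whisker_exchange_assoc]
      simp
    · obtain rfl := h'.eq_of_empty_right
      obtain rfl := k'.eq_of_empty_left
      rw [pointMul_empty_left, pointMul_empty_right]
      simp

end Point

/-- The middle crossings match only because each braiding is inverse to the reversed one. This gives
commutativity of a product of systems. -/
theorem braiding_comp_tensorμ (X₁ X₂ Y₁ Y₂ : V) :
    (β_ (X₁ ⊗ X₂) (Y₁ ⊗ Y₂)).hom ≫ tensorμ Y₁ Y₂ X₁ X₂ =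
      tensorμ X₁ X₂ Y₁ Y₂ ≫ ((β_ X₁ Y₁).hom ⊗ₘ (β_ X₂ Y₂).hom) := by
  simp [tensorμ, SymmetricCategory.braiding_swap_eq_inv_braiding Y₁ X₂,
    SymmetricCategory.braiding_swap_eq_inv_braiding Y₂ X₁, MonoidalCategory.tensorHom_def]

/-- The tensor product of two systems. -/
def prod {ι₁ ι₂ : Type} {r₁ : ι₁ → ι₁ → Prop} {r₂ : ι₂ → ι₂ → Prop}
    (A : TensorSystem V r₁) (B : TensorSystem V r₂) : TensorSystem V (Sum.LiftRel r₁ r₂) where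
  obj s := A.obj (Sum.inl ⁻¹' s) ⊗ B.obj (Sum.inr ⁻¹' s)
  unit := (λ_ (𝟙_ V)).symm ≪≫ (A.unit ⊗ᵢ B.unit)
  mul h := ⟨tensorμ _ _ _ _, tensorδ _ _ _ _, by simp, by simp⟩ ≪≫
    (A.mul (h.preimage Sum.inl fun _ _ => .inl) ⊗ᵢ B.mul (h.preimage Sum.inr fun _ _ => .inr))
  unit_mul {a} h := by
    have h₁ := A.unit_mul (h.preimage Sum.inl fun _ _ => .inl)
    have h₂ := B.unit_mul (h.preimage Sum.inr fun _ _ => .inr)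
    simp only [Iso.trans_hom, Iso.symm_hom, tensorIso_hom, comp_whiskerRight, Category.assoc]
    -- Naturality of the interchange isolates the unit axioms of the two factors; what remains is
    -- unitality of `⊗` as a monoidal functor.
    refine (congrArg _ (tensorμ_natural_left_assoc A.unit.hom B.unit.hom _ _ _)).trans ?_
    rw [tensorHom_comp_tensorHom]
    exact (congrArg _ (congrArg _ (congrArg₂ tensorHom h₁ h₂))).trans
      (tensor_left_unitality _ _).symm
  mul_comm h := by
    simp only [Iso.trans_hom, tensorIso_hom]
    rw [← Category.assoc, braiding_comp_tensorμ, Category.assoc, tensorHom_comp_tensorHom,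
      A.mul_comm, B.mul_comm]
  mul_assoc h h' k k' := by
    simp only [Iso.trans_hom, tensorIso_hom, comp_whiskerRight, Category.assoc,
      MonoidalCategory.whiskerLeft_comp]
    rw [tensorμ_natural_left_assoc, tensorHom_comp_tensorHom,
      A.mul_assoc _ _ (k.preimage Sum.inl fun _ _ => .inl) (k'.preimage Sum.inl fun _ _ => .inl),
      B.mul_assoc _ _ (k.preimage Sum.inr fun _ _ => .inr) (k'.preimage Sum.inr fun _ _ => .inr),
      ← tensorHom_comp_tensorHom, ← tensorHom_comp_tensorHom, tensorμ_natural_right_assoc]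
    simpa only [Category.assoc] using congrArg (· ≫ _) (tensor_associativity _ _ _ _ _ _)

end TensorSystem
end TensorSystem

/-! ### Canonical maps and their preservation by the structure maps. -/

section Canon

variable {V : Type u} [Category.{v} V] [MonoidalCategory V] [SymmetricCategory V]
  {ι : Type} {r : ι → ι → Prop}

/-- A class of canonical maps from the objects of a tensor system to `A`, depending on a labelling
by `ι` of the set `P` of positions of `A`. -/
def Canon (N : TensorSystem V r) (A : V) (P : Type) : Type v :=
  (P → ι) → ∀ K : Set ι, (N.obj K ⟶ A) → Prop

namespace Canon

variable {N : TensorSystem V r} {A B X Y Z : V} {P Q S : Type}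
  {r' : P → P → Prop}

/-- The canonical map to the unit object. -/
def unit (N : TensorSystem V r) : Canon N (𝟙_ V) Empty := fun _ K c =>
  ∃ hK : K = ∅, c = eqToHom (congrArg N.obj hK) ≫ N.unit.inv

/-- The canonical maps to a tensor product. -/
def tensor (p : Canon N A P) (q : Canon N B Q) : Canon N (A ⊗ B) (P ⊕ Q) := fun ℓ K c =>
  ∃ (a b : Set ι) (h : Split r K a b) (f : N.obj a ⟶ A) (g : N.obj b ⟶ B),
    p (ℓ ∘ Sum.inl) a f ∧ q (ℓ ∘ Sum.inr) b g ∧ c = (N.mul h).inv ≫ (f ⊗ₘ g)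

/-- There is at most one canonical map for each labelling, and it is defined on the object indexed
by the image of the labelling. -/
structure Unique (p : Canon N A P) : Prop where
  eq_range {ℓ K c} : p ℓ K c → K = Set.range ℓ
  eq {ℓ K c c'} : p ℓ K c → p ℓ K c' → c = c'

theorem unique_unit (N : TensorSystem V r) : (unit N).Unique where
  eq_range := by rintro ℓ K c ⟨rfl, -⟩; exact (Set.range_eq_empty ℓ).symm
  eq := by rintro ℓ K c c' ⟨-, rfl⟩ ⟨-, rfl⟩; rfl

/-- By `eq_range` the two blocks of the splitting must be the images of the two halves of the
labelling, so the definition of `tensor` leaves no choice. -/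
theorem Unique.tensor {p : Canon N A P} {q : Canon N B Q} (hp : p.Unique) (hq : q.Unique) :
    (p.tensor q).Unique where
  eq_range := by
    rintro ℓ K c ⟨a, b, h, f, g, hf, hg, rfl⟩
    rw [h.eq_union, hp.eq_range hf, hq.eq_range hg]
    ext i
    simp
  eq := by
    rintro ℓ K c c' ⟨a, b, h, f, g, hf, hg, rfl⟩ ⟨a', b', h', f', g', hf', hg', rfl⟩
    obtain rfl := (hp.eq_range hf).trans (hp.eq_range hf').symm
    obtain rfl := (hq.eq_range hg).trans (hq.eq_range hg').symm
    rw [hp.eq hf hf', hq.eq hg hg']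

/-- The labelling `ℓ` admits an invertible canonical map. -/
def Admits (p : Canon N A P) (ℓ : P → ι) : Prop :=
  ∃ c : N.obj (Set.range ℓ) ⟶ A, p ℓ _ c ∧ IsIso c

theorem admits_unit (N : TensorSystem V r) (ℓ : Empty → ι) : (unit N).Admits ℓ :=
  ⟨_, ⟨Set.range_eq_empty ℓ, rfl⟩, inferInstance⟩

theorem Admits.tensor {p : Canon N A P} {q : Canon N B Q} {ℓ : P ⊕ Q → ι}
    (hp : p.Admits (ℓ ∘ Sum.inl)) (hq : q.Admits (ℓ ∘ Sum.inr))
    (h : ∀ i j, ¬ r (ℓ (.inl i)) (ℓ (.inr j)) ∧ ¬ r (ℓ (.inr j)) (ℓ (.inl i))) :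
    (p.tensor q).Admits ℓ := by
  obtain ⟨f, hf, _⟩ := hp
  obtain ⟨g, hg, _⟩ := hq
  have hs : Split r (Set.range ℓ) (Set.range (ℓ ∘ Sum.inl)) (Set.range (ℓ ∘ Sum.inr)) := by
    refine ⟨by ext i; simp, ?_⟩
    rintro _ ⟨i, rfl⟩ _ ⟨j, rfl⟩
    exact h i j
  exact ⟨_, ⟨_, _, hs, f, g, hf, hg, rfl⟩, inferInstance⟩

/-- `φ` takes canonical maps to canonical maps, with `σ` describing its effect on positions. -/
def Preserves (p : Canon N A P) (q : Canon N B Q) (σ : P ≃ Q) (φ : A ⟶ B) : Prop :=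
  ∀ ⦃ℓ K c⦄, p (ℓ ∘ σ) K c → q ℓ K (c ≫ φ)

variable (p : Canon N X P) (q : Canon N Y Q) (s : Canon N Z S)

/-- Each target position gets as label the source position it comes from. The labelling of the
result thus depends only on the permutation. -/
theorem Preserves.of_id {M : TensorSystem V (ι := P) r'} {p : Canon M X P} {q : Canon M Y Q}
    {σ : P ≃ Q} {φ : X ⟶ Y} (h : p.Preserves q σ φ) {K : Set P} {c : M.obj K ⟶ X}
    (hc : p id K c) : q σ.symm K (c ≫ φ) :=
  h (ℓ := σ.symm) (by rwa [Equiv.symm_comp_self])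

theorem preserves_id : p.Preserves p (Equiv.refl _) (𝟙 X) := fun ℓ K c h => by
  rw [Category.comp_id]; exact h

variable {p q s} in
theorem Preserves.comp {σ : P ≃ Q} {τ : Q ≃ S} {φ : X ⟶ Y} {ψ : Y ⟶ Z}
    (h : p.Preserves q σ φ) (h' : q.Preserves s τ ψ) :
    p.Preserves s (σ.trans τ) (φ ≫ ψ) := fun ℓ K c hc => by
  rw [← Category.assoc]; exact h' (h hc)

variable {q s} in
theorem Preserves.whiskerLeft {σ : Q ≃ S} {φ : Y ⟶ Z} (h : q.Preserves s σ φ) :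
    (p.tensor q).Preserves (p.tensor s) (Equiv.sumCongr (Equiv.refl _) σ) (X ◁ φ) := by
  rintro ℓ K c ⟨a, b, hs, f, g, hf, hg, rfl⟩
  exact ⟨a, b, hs, f, g ≫ φ, hf, h hg, by simp [MonoidalCategory.tensorHom_def]⟩

variable {q s} in
theorem Preserves.whiskerRight {σ : Q ≃ S} {φ : Y ⟶ Z} (h : q.Preserves s σ φ) :
    (q.tensor p).Preserves (s.tensor p) (Equiv.sumCongr σ (Equiv.refl _)) (φ ▷ X) := by
  rintro ℓ K c ⟨a, b, hs, f, g, hf, hg, rfl⟩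
  exact ⟨a, b, hs, f ≫ φ, g, h hf, hg, by simp [tensorHom_def']⟩

/-- Once the invertible multiplications are cancelled, this is `mul_assoc` for the two bracketings
of one triple splitting. -/
theorem preserves_associator : ((p.tensor q).tensor s).Preserves (p.tensor (q.tensor s))
    (Equiv.sumAssoc P Q S) (α_ X Y Z).hom := by
  rintro ℓ K _ ⟨d, k, h, _, z, ⟨a, b, h', x, y, hx, hy, rfl⟩, hz, rfl⟩
  obtain ⟨h₁, h₂⟩ := h.assoc h'
  refine ⟨a, b ∪ k, h₁, x, _, hx, ⟨b, k, h₂, y, z, hy, hz, rfl⟩, ?_⟩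
  rw [← cancel_epi (N.mul h).hom, ← cancel_epi ((N.mul h').hom ▷ _),
    ← Category.assoc _ (N.mul h).hom ((N.mul h₁).inv ≫ _), N.mul_assoc h h' h₁ h₂]
  simp [MonoidalCategory.tensorHom_def, whisker_exchange_assoc]

theorem preserves_associator_inv : (p.tensor (q.tensor s)).Preserves ((p.tensor q).tensor s)
    (Equiv.sumAssoc P Q S).symm (α_ X Y Z).inv := by
  rintro ℓ K _ ⟨a, e, h, x, _, hx, ⟨b, k, h', y, z, hy, hz, rfl⟩, rfl⟩
  obtain ⟨h₁, h₂⟩ := h.assoc_symm h'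
  refine ⟨a ∪ b, k, h₁, _, z, ⟨a, b, h₂, x, y, hx, hy, rfl⟩, hz, ?_⟩
  rw [← cancel_mono (α_ X Y Z).hom, ← cancel_epi (N.mul h₁).hom,
    ← cancel_epi ((N.mul h₂).hom ▷ _), ← Category.assoc _ (N.mul h₁).hom ((_ ≫ _) ≫ _),
    N.mul_assoc h₁ h₂ h h']
  simp [MonoidalCategory.tensorHom_def, whisker_exchange_assoc]

theorem preserves_braiding : (p.tensor q).Preserves (q.tensor p) (Equiv.sumComm P Q)
    (β_ X Y).hom := by
  rintro ℓ K _ ⟨a, b, h, x, y, hx, hy, rfl⟩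
  refine ⟨b, a, h.symm, y, x, hy, hx, ?_⟩
  rw [← cancel_epi (N.mul h).hom]
  conv_rhs => rw [← N.mul_comm h]
  simp

theorem preserves_leftUnitor : ((unit N).tensor p).Preserves p (Equiv.emptySum Empty P)
    (λ_ X).hom := by
  rintro ℓ K _ ⟨a, b, h, _, y, ⟨rfl, rfl⟩, hy, rfl⟩
  obtain rfl := h.eq_of_empty_left
  suffices hc : ((N.mul h).inv ≫ (N.unit.inv ⊗ₘ y)) ≫ (λ_ X).hom = y by
    simp only [eqToHom_refl, Category.id_comp, hc]
    exact hy
  rw [← cancel_epi (N.mul h).hom, ← cancel_epi (N.unit.hom ▷ _),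
    ← Category.assoc _ (N.mul h).hom y, N.unit_mul h]
  simp [MonoidalCategory.tensorHom_def]

theorem preserves_leftUnitor_inv : p.Preserves ((unit N).tensor p) (Equiv.emptySum Empty P).symm
    (λ_ X).inv := by
  intro ℓ K y hy
  have h := Split.empty_left r K
  refine ⟨∅, K, h, _, y, ⟨rfl, rfl⟩, hy, ?_⟩
  rw [← cancel_mono (λ_ X).hom, ← cancel_epi (N.mul h).hom, ← cancel_epi (N.unit.hom ▷ _),
    ← Category.assoc _ (N.mul h).hom ((_ ≫ _) ≫ _), N.unit_mul h]
  simp [MonoidalCategory.tensorHom_def]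

theorem preserves_rightUnitor : (p.tensor (unit N)).Preserves p (Equiv.sumEmpty P Empty)
    (ρ_ X).hom := by
  rw [← braiding_leftUnitor]
  exact (preserves_braiding p (unit N)).comp (preserves_leftUnitor p)

theorem preserves_rightUnitor_inv : p.Preserves (p.tensor (unit N)) (Equiv.sumEmpty P Empty).symm
    (ρ_ X).inv := by
  have h : (ρ_ X).inv = (λ_ X).inv ≫ (β_ (𝟙_ V) X).hom := by simp
  rw [h]
  exact (preserves_leftUnitor_inv p).comp (preserves_braiding (unit N) p)

end Canon

end Canon

/-! ### Comparison of tensor systems along a lax symmetric monoidal functor. -/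

section Transfer

variable {C : Type u} [Category.{v} C] [MonoidalCategory C] [SymmetricCategory C]
  {D : Type u₁} [Category.{v₁} D] [MonoidalCategory D] [SymmetricCategory D]
  {ι : Type} {r r' : ι → ι → Prop}

open Functor.LaxMonoidal

/-- A map of tensor systems along a lax symmetric monoidal functor. -/
structure Transfer (F : C ⥤ D) [F.LaxBraided] (M : TensorSystem D r) (N : TensorSystem C r')
    where
  rel : ∀ i j, r' i j → r i j
  app (K : Set ι) : M.obj K ⟶ F.obj (N.obj K)
  unit : M.unit.hom ≫ app ∅ = ε F ≫ F.map N.unit.hom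
  mul {s a b : Set ι} (h : Split r s a b) :
    (M.mul h).hom ≫ app s = (app a ⊗ₘ app b) ≫ μ F _ _ ≫ F.map (N.mul (h.mono rel)).hom

namespace Canon

variable {F : C ⥤ D} [F.LaxBraided] {M : TensorSystem D r} {N : TensorSystem C r'}
  (t : Transfer F M N) {A B : C} {P Q : Type}

/-- The canonical maps to `F A` determined by canonical maps to `A`. -/
def map (p : Canon N A P) : Canon M (F.obj A) P := fun ℓ K c =>
  ∃ f, p ℓ K f ∧ c = t.app K ≫ F.map f

theorem Unique.map {p : Canon N A P} (hp : p.Unique) : (p.map t).Unique where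
  eq_range := by rintro ℓ K c ⟨f, hf, -⟩; exact hp.eq_range hf
  eq := by rintro ℓ K c c' ⟨f, hf, rfl⟩ ⟨f', hf', rfl⟩; rw [hp.eq hf hf']

theorem Preserves.map {p : Canon N A P} {q : Canon N B Q} {σ : P ≃ Q} {φ : A ⟶ B}
    (h : p.Preserves q σ φ) : (p.map t).Preserves (q.map t) σ (F.map φ) := by
  rintro ℓ K _ ⟨f, hf, rfl⟩
  exact ⟨_, h hf, by simp⟩

/-- A splitting for `M` is one for `N`, since `N` has the smaller relation; the `mul` axiom of `t`
then exchanges the two multiplications. The converse on splittings may fail, in accordance with `μ`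
not being invertible. -/
theorem preserves_μ (p : Canon N A P) (q : Canon N B Q) :
    ((p.map t).tensor (q.map t)).Preserves ((p.tensor q).map t) (Equiv.refl _) (μ F A B) := by
  rintro ℓ K _ ⟨a, b, h, _, _, ⟨f, hf, rfl⟩, ⟨g, hg, rfl⟩, rfl⟩
  refine ⟨_, ⟨a, b, h.mono t.rel, f, g, hf, hg, rfl⟩, ?_⟩
  rw [← cancel_epi (M.mul h).hom, ← Category.assoc _ (t.app K), t.mul h,
    ← tensorHom_comp_tensorHom]
  simp only [Category.assoc, Iso.hom_inv_id_assoc, μ_natural, ← F.map_comp]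

theorem preserves_ε : (unit M).Preserves ((unit N).map t) (Equiv.refl _) (ε F) := by
  rintro ℓ _ _ ⟨rfl, rfl⟩
  refine ⟨_, ⟨rfl, rfl⟩, ?_⟩
  rw [← cancel_epi M.unit.hom, ← Category.assoc _ (t.app ∅), t.unit]
  simp [← F.map_comp]

/-- A canonical map to `F.obj (𝟙_ C)` exists only over `∅`, where the unit axiom of `t` rewrites it
as `M.unit.inv ≫ ε F`. -/
theorem preserves_inv_ε [IsIso (ε F)] :
    ((unit N).map t).Preserves (unit M) (Equiv.refl _) (inv (ε F)) := by
  rintro ℓ _ _ ⟨_, ⟨rfl, rfl⟩, rfl⟩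
  refine ⟨rfl, ?_⟩
  rw [← cancel_mono (ε F), ← cancel_epi M.unit.hom]
  simp only [Category.assoc, IsIso.inv_hom_id, Category.comp_id]
  rw [← Category.assoc _ (t.app ∅), t.unit]
  simp [← F.map_comp]

end Canon

end Transfer

section Transfer

open Functor.LaxMonoidal

variable {C : Type u} [Category.{v} C] [MonoidalCategory C] [SymmetricCategory C]
  {D : Type u₁} [Category.{v₁} D] [MonoidalCategory D] [SymmetricCategory D]

namespace Transfer

variable (F : C ⥤ D) [F.LaxBraided]

/-- With an empty block the multiplication of a `point` system is essentially a unitor, and left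
unitality of `F` expresses it through `μ`. This is why identities form a transfer. -/
theorem point_mul_empty_left [IsIso (ε F)] {ι : Type} {r : ι → ι → Prop} (N : TensorSystem C r)
    {s b : Set ι} (h : Split (fun _ _ => True) s ∅ b) :
    ((TensorSystem.point (fun K => F.obj (N.obj K)) (asIso (ε F) ≪≫ F.mapIso N.unit)).mul h).hom =
      μ F (N.obj ∅) (N.obj b) ≫ F.map (N.mul (h.mono (r' := r) fun _ _ _ => trivial)).hom := by
  obtain rfl := h.eq_of_empty_left
  refine (TensorSystem.pointMul_empty_left _ _ h).trans ?_
  have h' := N.unit_mul (h.mono fun _ _ _ => trivial)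
  rw [left_unitality, ← h', F.map_comp, ← μ_natural_left_assoc, ← comp_whiskerRight_assoc,
    ← comp_whiskerRight_assoc]
  simp

theorem point_mul [IsIso (ε F)] {ι : Type} {r : ι → ι → Prop} (N : TensorSystem C r)
    {s a b : Set ι} (h : Split (fun _ _ => True) s a b) :
    ((TensorSystem.point (fun K => F.obj (N.obj K)) (asIso (ε F) ≪≫ F.mapIso N.unit)).mul h).hom =
      μ F (N.obj a) (N.obj b) ≫ F.map (N.mul (h.mono (r' := r) fun _ _ _ => trivial)).hom := by
  rcases h.empty_or_empty with rfl | rfl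
  · exact point_mul_empty_left F N h
  · refine (TensorSystem.mul_comm _ h).symm.trans
      ((congrArg (_ ≫ ·) (point_mul_empty_left F N h.symm)).trans ?_)
    have h' := N.mul_comm (h.mono (r' := r) fun _ _ _ => trivial)
    rw [← h', F.map_comp, Functor.LaxBraided.braided_assoc]
    rfl

/-- The transfer to `F ∘ N`, regarded as a system in which all elements are related. -/
noncomputable def point [IsIso (ε F)] {ι : Type} {r : ι → ι → Prop} (N : TensorSystem C r) :
    Transfer F (TensorSystem.point (fun K => F.obj (N.obj K)) (asIso (ε F) ≪≫ F.mapIso N.unit))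
      N where
  rel _ _ _ := trivial
  app _ := 𝟙 _
  unit := by simp [TensorSystem.point]
  mul h := (Category.comp_id _).trans ((point_mul F N h).trans
    ((congrArg (· ≫ _) (id_tensorHom_id _ _)).trans (Category.id_comp _)).symm)

/-- The transfer between the trivial systems on the empty set. -/
def empty : Transfer F
    (TensorSystem.point (ι := Empty) (fun _ => 𝟙_ D) (Iso.refl _))
    (TensorSystem.point (ι := Empty) (fun _ => 𝟙_ C) (Iso.refl _)) where
  rel _ _ _ := trivial
  app _ := ε F
  unit := by simp [TensorSystem.point]
  mul {s a b} h := by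
    obtain rfl := Subsingleton.elim s ∅
    obtain rfl := Subsingleton.elim a ∅
    obtain rfl := Subsingleton.elim b ∅
    simp only [TensorSystem.point, TensorSystem.pointMul_empty_left]
    simp [tensorHom_def', ← left_unitality]

variable {F} in
/-- The product of two transfers. -/
def prod {ι₁ ι₂ : Type} {r₁ r₁' : ι₁ → ι₁ → Prop} {r₂ r₂' : ι₂ → ι₂ → Prop}
    {M₁ : TensorSystem D r₁} {N₁ : TensorSystem C r₁'} (t₁ : Transfer F M₁ N₁)
    {M₂ : TensorSystem D r₂} {N₂ : TensorSystem C r₂'} (t₂ : Transfer F M₂ N₂) :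
    Transfer F (M₁.prod M₂) (N₁.prod N₂) where
  rel := by
    rintro _ _ (h | h)
    exacts [.inl (t₁.rel _ _ h), .inr (t₂.rel _ _ h)]
  app K := (t₁.app _ ⊗ₘ t₂.app _) ≫ μ F _ _
  unit := by
    have h := congrArg₂ tensorHom t₁.unit t₂.unit
    simp only [← tensorHom_comp_tensorHom] at h
    simp only [TensorSystem.prod, Iso.trans_hom, Iso.symm_hom, tensorIso_hom, Category.assoc,
      F.map_comp]
    refine (congrArg _ ((Category.assoc _ _ _).symm.trans
      (congrArg (· ≫ μ F _ _) h))).trans ?_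
    simp only [Category.assoc]
    rw [μ_natural, tensorHom_def'_assoc, ← leftUnitor_inv_naturality_assoc,
      left_unitality_inv_assoc]
  mul h := by
    simp only [TensorSystem.prod, Iso.trans_hom, tensorIso_hom, Category.assoc]
    rw [tensorHom_comp_tensorHom_assoc, t₁.mul, t₂.mul]
    simp only [← tensorHom_comp_tensorHom, Category.assoc, F.map_comp]
    -- The symmetry axiom of `F` enters here, as compatibility of `μ` with the interchange
    -- `tensorμ`.
    rw [μ_natural, ← tensorμ_comp_μ_tensorHom_μ_comp_μ_assoc, tensorμ_natural_assoc]

variable {F} in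
theorem isIso_prod_app {ι₁ ι₂ : Type} {r₁ r₁' : ι₁ → ι₁ → Prop} {r₂ r₂' : ι₂ → ι₂ → Prop}
    {M₁ : TensorSystem D r₁} {N₁ : TensorSystem C r₁'} (t₁ : Transfer F M₁ N₁)
    {M₂ : TensorSystem D r₂} {N₂ : TensorSystem C r₂'} (t₂ : Transfer F M₂ N₂)
    (K : Set (ι₁ ⊕ ι₂)) (h₁ : IsIso (t₁.app (Sum.inl ⁻¹' K))) (h₂ : IsIso (t₂.app (Sum.inr ⁻¹' K)))
    (hμ : IsIso (μ F (N₁.obj (Sum.inl ⁻¹' K)) (N₂.obj (Sum.inr ⁻¹' K)))) :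
    IsIso ((t₁.prod t₂).app K) :=
  IsIso.comp_isIso' (inferInstanceAs (IsIso (t₁.app _ ⊗ₘ t₂.app _))) hμ

end Transfer

end Transfer

/-! ### Tensor systems and transfers attached to words. -/

section Word

variable {L : Type u} {p : L → Type}

/-- The relation on letter occurrences in a word given by relations on the occurrences in each
letter. -/
def Word.rel (r : ∀ x : L, p x → p x → Prop) : ∀ X : Word L, X.Pos p → X.Pos p → Prop
  | .of x => r x
  | .unit => fun _ _ => True
  | .tensor X Y => Sum.LiftRel (rel r X) (rel r Y)

/-- The family indexed by letter occurrences in a word given by families for each letter. -/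
def Word.family {α : Type w} (f : ∀ x : L, p x → α) : ∀ X : Word L, X.Pos p → α
  | .of x => f x
  | .unit => Empty.elim
  | .tensor X Y => Sum.elim (family f X) (family f Y)

/-- Used for the system in `C`: if only equal occurrences are related, every disjoint union is a
splitting. -/
theorem Word.rel_iff_eq {r : ∀ x : L, p x → p x → Prop} (hr : ∀ x i j, r x i j ↔ i = j)
    (X : Word L) (i j : X.Pos p) : X.rel r i j ↔ i = j := by
  induction X with
  | of x => exact hr x i j
  | unit => exact i.elim
  | tensor X Y hX hY =>
    rcases i with i | i <;> rcases j with j | j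
    · exact Sum.liftRel_inl_inl.trans ((hX i j).trans Sum.inl_injective.eq_iff.symm)
    · exact iff_of_false Sum.not_liftRel_inl_inr Sum.inl_ne_inr
    · exact iff_of_false Sum.not_liftRel_inr_inl Sum.inr_ne_inl
    · exact Sum.liftRel_inr_inr.trans ((hY i j).trans Sum.inr_injective.eq_iff.symm)

section System

variable {V : Type u₁} [Category.{v} V] [MonoidalCategory V] [SymmetricCategory V]

/-- The tensor system on letter occurrences in a word given by systems for each letter. -/
noncomputable def wordSystem {r : ∀ x : L, p x → p x → Prop}
    (S : ∀ x : L, TensorSystem V (r x)) : ∀ X : Word L, TensorSystem V (X.rel r)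
  | .of x => S x
  | .unit => TensorSystem.point (ι := Empty) (fun _ => 𝟙_ V) (Iso.refl _)
  | .tensor X Y => (wordSystem S X).prod (wordSystem S Y)

/-- The values of a system at singletons are isomorphic to the given objects. -/
def TensorSystem.HasLetters {ι : Type} {r : ι → ι → Prop} (N : TensorSystem V r) (l : ι → V) :
    Prop :=
  ∀ i, Nonempty (N.obj {i} ≅ l i)

/-- A singleton lies in one summand; the other factor is indexed by `∅` and so is a unit. -/
theorem TensorSystem.HasLetters.prod {ι₁ ι₂ : Type} {r₁ : ι₁ → ι₁ → Prop} {r₂ : ι₂ → ι₂ → Prop}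
    {A : TensorSystem V r₁} {B : TensorSystem V r₂} {l₁ : ι₁ → V} {l₂ : ι₂ → V}
    (hA : A.HasLetters l₁) (hB : B.HasLetters l₂) :
    (A.prod B).HasLetters (Sum.elim l₁ l₂) := by
  rintro (i | i)
  · obtain ⟨e⟩ := hA i
    have h₁ : Sum.inl (β := ι₂) ⁻¹' {Sum.inl i} = ({i} : Set ι₁) := by ext; simp
    have h₂ : Sum.inr (α := ι₁) ⁻¹' {Sum.inl i} = (∅ : Set ι₂) := by ext; simp
    exact ⟨((eqToIso (congrArg A.obj h₁) ≪≫ e) ⊗ᵢ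
      (eqToIso (congrArg B.obj h₂) ≪≫ B.unit.symm)) ≪≫ ρ_ _⟩
  · obtain ⟨e⟩ := hB i
    have h₁ : Sum.inl (β := ι₂) ⁻¹' {Sum.inr i} = (∅ : Set ι₁) := by ext; simp
    have h₂ : Sum.inr (α := ι₁) ⁻¹' {Sum.inr i} = ({i} : Set ι₂) := by ext; simp
    exact ⟨((eqToIso (congrArg A.obj h₁) ≪≫ A.unit.symm) ⊗ᵢ
      (eqToIso (congrArg B.obj h₂) ≪≫ e)) ≪≫ λ_ _⟩

theorem hasLetters_wordSystem {r : ∀ x : L, p x → p x → Prop} (S : ∀ x : L, TensorSystem V (r x))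
    (l : ∀ x : L, p x → V) (h : ∀ x, (S x).HasLetters (l x)) (X : Word L) :
    (wordSystem S X).HasLetters (X.family l) := by
  induction X with
  | of x => exact h x
  | unit => exact fun i => i.elim
  | tensor X Y hX hY => exact hX.prod hY

open Classical in
/-- The tensor system on a single letter. -/
noncomputable def letterSystem (A : V) : TensorSystem V (fun _ _ : Unit => True) :=
  TensorSystem.point (fun K => if K = ∅ then 𝟙_ V else A) (eqToIso (if_pos rfl).symm)

theorem hasLetters_letterSystem (A : V) : (letterSystem A).HasLetters (fun _ => A) := fun i =>
  ⟨eqToIso (if_neg (Set.singleton_ne_empty i))⟩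

end System

section WordTransfer

open Functor.LaxMonoidal

variable {C : Type u₁} [Category.{v} C] [MonoidalCategory C] [SymmetricCategory C]
  {D : Type w} [Category.{v₁} D] [MonoidalCategory D] [SymmetricCategory D]
  {F : C ⥤ D} [F.LaxBraided] {r r' : ∀ x : L, p x → p x → Prop}
  {M : ∀ x : L, TensorSystem D (r x)} {N : ∀ x : L, TensorSystem C (r' x)}

/-- The transfer between word systems given by transfers for each letter. -/
noncomputable def wordTransfer (t : ∀ x, Transfer F (M x) (N x)) :
    ∀ X : Word L, Transfer F (wordSystem M X) (wordSystem N X)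
  | .of x => t x
  | .unit => Transfer.empty F
  | .tensor X Y => (wordTransfer t X).prod (wordTransfer t Y)

/-- Left unitality identifies this `μ` with a unitor up to isomorphisms, one of which is `ε F`
whiskered. -/
theorem isIso_μ_left [IsIso (ε F)] {A : C} (e : 𝟙_ C ≅ A) (B : C) : IsIso (μ F A B) := by
  have h : ε F ▷ F.obj B ≫ F.map e.hom ▷ F.obj B ≫ μ F A B =
      (λ_ (F.obj B)).hom ≫ F.map ((λ_ B).inv ≫ e.hom ▷ B) := by
    simp
  have : IsIso (ε F ▷ F.obj B ≫ F.map e.hom ▷ F.obj B ≫ μ F A B) := h ▸ inferInstance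
  have := IsIso.of_isIso_comp_left (ε F ▷ F.obj B) (F.map e.hom ▷ F.obj B ≫ μ F A B)
  exact IsIso.of_isIso_comp_left (F.map e.hom ▷ F.obj B) (μ F A B)

theorem isIso_μ_right [IsIso (ε F)] (A : C) {B : C} (e : 𝟙_ C ≅ B) : IsIso (μ F A B) := by
  have h : F.obj A ◁ ε F ≫ F.obj A ◁ F.map e.hom ≫ μ F A B =
      (ρ_ (F.obj A)).hom ≫ F.map ((ρ_ A).inv ≫ A ◁ e.hom) := by
    simp
  have : IsIso (F.obj A ◁ ε F ≫ F.obj A ◁ F.map e.hom ≫ μ F A B) := h ▸ inferInstance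
  have := IsIso.of_isIso_comp_left (F.obj A ◁ ε F) (F.obj A ◁ F.map e.hom ≫ μ F A B)
  exact IsIso.of_isIso_comp_left (F.obj A ◁ F.map e.hom) (μ F A B)

/-- Pairwise related occurrences lie in at most one letter of `X`. At each tensor node one block is
therefore empty, so every `μ` in the transfer has a unit as an argument. -/
theorem isIso_wordTransfer_app [IsIso (ε F)] (t : ∀ x, Transfer F (M x) (N x))
    (ht : ∀ x K, IsIso ((t x).app K)) (X : Word L) (K : Set (X.Pos p))
    (hK : ∀ i ∈ K, ∀ j ∈ K, X.rel r i j) : IsIso ((wordTransfer t X).app K) := by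
  induction X with
  | of x => exact ht x K
  | unit => exact inferInstanceAs (IsIso (ε F))
  | tensor X Y hX hY =>
    have h₁ := hX (Sum.inl ⁻¹' K) fun i hi j hj => by cases hK _ hi _ hj; assumption
    have h₂ := hY (Sum.inr ⁻¹' K) fun i hi j hj => by cases hK _ hi _ hj; assumption
    have hμ : IsIso (μ F ((wordSystem N X).obj (Sum.inl ⁻¹' K))
        ((wordSystem N Y).obj (Sum.inr ⁻¹' K))) := by
      rcases (Sum.inl ⁻¹' K).eq_empty_or_nonempty with h | ⟨i, hi⟩
      · exact isIso_μ_left ((wordSystem N X).unit ≪≫ eqToIso (by rw [h])) _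
      · rcases (Sum.inr ⁻¹' K).eq_empty_or_nonempty with h | ⟨j, hj⟩
        · exact isIso_μ_right _ ((wordSystem N Y).unit ≪≫ eqToIso (by rw [h]))
        · cases hK _ hi _ hj
    exact Transfer.isIso_prod_app _ _ K h₁ h₂ hμ

end WordTransfer

end Word

/-! ### Canonical maps to the values of words. -/

section WordCanon

variable {L : Type u} {p : L → Type} {V : Type u₁} [Category.{v} V] [MonoidalCategory V]
  [SymmetricCategory V] {ι : Type} {r : ι → ι → Prop} {N : TensorSystem V r}

/-- Transport of a class of canonical maps along an equality of targets. -/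
def Canon.cast {A B : V} {P : Type} (h : A = B) (q : Canon N A P) : Canon N B P := h ▸ q

theorem Canon.Unique.cast {A B : V} {P : Type} (h : A = B) {q : Canon N A P} (hq : q.Unique) :
    (q.cast h).Unique := by
  subst h; exact hq

theorem Canon.Admits.cast {A B : V} {P : Type} (h : A = B) {q : Canon N A P} {ℓ : P → ι}
    (hq : q.Admits ℓ) : (q.cast h).Admits ℓ := by
  subst h; exact hq

section

-- `E` stays abstract so that it can be `evalObj` in the lax case and its opposite in the oplax
-- case; the equalities are then `rfl`.
variable (E : Word L → V) (hu : 𝟙_ V = E .unit) (ht : ∀ X Y, E X ⊗ E Y = E (X.tensor Y))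
  (leaf : ∀ x : L, Canon N (E (.of x)) (p x))

/-- The canonical maps to the values of words, given those to the values of letters. -/
def wordCanon : ∀ X : Word L, Canon N (E X) (X.Pos p)
  | .of x => leaf x
  | .unit => (Canon.unit N).cast hu
  | .tensor X Y => ((wordCanon X).tensor (wordCanon Y)).cast (ht X Y)

variable {leaf} in
theorem unique_wordCanon (h : ∀ x, (leaf x).Unique) (X : Word L) :
    (wordCanon E hu ht leaf X).Unique := by
  induction X with
  | of x => exact h x
  | unit => exact (Canon.unique_unit N).cast hu
  | tensor X Y hX hY => exact (hX.tensor hY).cast (ht X Y)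

/-- A labelling of the letter occurrences of a word is separated if it is injective, compatible
with given values of letters, and reflects and preserves the relation on letter occurrences. -/
structure Separated {α : Type w} (l : ι → α) (r : ι → ι → Prop) (f : ∀ x : L, p x → α)
    (r' : ∀ x : L, p x → p x → Prop) (X : Word L) (ℓ : X.Pos p → ι) : Prop where
  injective : Function.Injective ℓ
  family_eq : ∀ i, l (ℓ i) = X.family f i
  rel_iff : ∀ i j, r (ℓ i) (ℓ j) ↔ X.rel r' i j

variable {leaf} in
-- Separatedness restricts to both halves of a tensor product, and `rel_iff` makes their images
-- unrelated, so the image of the labelling splits.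
theorem admits_wordCanon {α : Type w} {l : ι → α} {f : ∀ x : L, p x → α}
    {r' : ∀ x : L, p x → p x → Prop}
    (h : ∀ x ℓ, Separated l r f r' (.of x) ℓ → (leaf x).Admits ℓ) (X : Word L) (ℓ : X.Pos p → ι)
    (hℓ : Separated l r f r' X ℓ) : (wordCanon E hu ht leaf X).Admits ℓ := by
  induction X with
  | of x => exact h x ℓ hℓ
  | unit => exact (Canon.admits_unit N ℓ).cast hu
  | tensor X Y hX hY =>
    refine ((hX _ ⟨hℓ.injective.comp Sum.inl_injective, fun i => hℓ.family_eq (.inl i),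
      fun i j => (hℓ.rel_iff (.inl i) (.inl j)).trans Sum.liftRel_inl_inl⟩).tensor
      (hY _ ⟨hℓ.injective.comp Sum.inr_injective, fun i => hℓ.family_eq (.inr i),
      fun i j => (hℓ.rel_iff (.inr i) (.inr j)).trans Sum.liftRel_inr_inr⟩) ?_).cast (ht X Y)
    exact fun i j => ⟨fun h' => Sum.not_liftRel_inl_inr ((hℓ.rel_iff _ _).1 h'),
      fun h' => Sum.not_liftRel_inr_inl ((hℓ.rel_iff _ _).1 h')⟩

end

section Letter

/-- The canonical maps to `A` from the object indexed by a singleton with value `A`. -/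
def letterCanon {l : ι → V} (e : ∀ i, N.obj {i} ≅ l i) (A : V) : Canon N A Unit := fun ℓ K c =>
  ∃ (hK : K = {ℓ ()}) (hA : l (ℓ ()) = A),
    c = eqToHom (congrArg N.obj hK) ≫ (e (ℓ ())).hom ≫ eqToHom hA

variable {l : ι → V} (e : ∀ i, N.obj {i} ≅ l i) (A : V)

theorem unique_letterCanon : (letterCanon e A).Unique where
  eq_range := by rintro ℓ K c ⟨rfl, -⟩; exact Set.range_unique.symm
  eq := by rintro ℓ K c c' ⟨-, -, rfl⟩ ⟨-, -, rfl⟩; rfl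

theorem admits_letterCanon (ℓ : Unit → ι) (h : l (ℓ ()) = A) : (letterCanon e A).Admits ℓ :=
  ⟨_, ⟨Set.range_unique, h, rfl⟩, inferInstance⟩

end Letter

section Eval

variable {G : Word L → Word L → Type u} (gp : ∀ {X Y : Word L}, G X Y → (X.Pos p ≃ Y.Pos p))

/-- The induction is over representatives, so the relations of the presentation never have to be
checked. -/
theorem preserves_evalHom (ob : L → V)
    (gm : ∀ {X Y : Word L}, G X Y → (evalObj ob X ⟶ evalObj ob Y))
    (leaf : ∀ x : L, Canon N (ob x) (p x))
    (hg : ∀ {X Y : Word L} (g : G X Y),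
      (wordCanon (evalObj ob) rfl (fun _ _ => rfl) leaf X).Preserves
        (wordCanon (evalObj ob) rfl (fun _ _ => rfl) leaf Y) (gp g) (gm g))
    {X Y : Word L} (f : Hom G X Y) :
    (wordCanon (evalObj ob) rfl (fun _ _ => rfl) leaf X).Preserves
      (wordCanon (evalObj ob) rfl (fun _ _ => rfl) leaf Y) (f.perm p gp) (evalHom ob gm f) := by
  induction f with
  | id X => exact Canon.preserves_id _
  | comp f g hf hg => exact hf.comp hg
  | whiskerLeft X f hf => exact hf.whiskerLeft _
  | whiskerRight f Y hf => exact hf.whiskerRight _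
  | assocHom X Y Z => exact Canon.preserves_associator _ _ _
  | assocInv X Y Z => exact Canon.preserves_associator_inv _ _ _
  | leftHom X => exact Canon.preserves_leftUnitor _
  | leftInv X => exact Canon.preserves_leftUnitor_inv _
  | rightHom X => exact Canon.preserves_rightUnitor _
  | rightInv X => exact Canon.preserves_rightUnitor_inv _
  | braid X Y => exact Canon.preserves_braiding _ _
  | gen g => exact hg g

end Eval

end WordCanon

/-! ### Evaluation in the opposite category. -/

section WordCanonOp

open Opposite

variable {L : Type u} {p : L → Type} {V : Type u₁} [Category.{v} V] [MonoidalCategory V]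
  [SymmetricCategory V] {ι : Type} {r : ι → ι → Prop}

instance : SymmetricCategory Vᵒᵖ where
  symmetry X Y := Quiver.Hom.unop_inj (SymmetricCategory.symmetry X.unop Y.unop)

variable {N : TensorSystem Vᵒᵖ r}
  {G : Word L → Word L → Type u} (gp : ∀ {X Y : Word L}, G X Y → (X.Pos p ≃ Y.Pos p))

/-- Opposites reverse arrows, so each structure map is matched with preservation by its inverse, and
positions are permuted backwards. -/
theorem preserves_op_evalHom (ob : L → V)
    (gm : ∀ {X Y : Word L}, G X Y → (evalObj ob X ⟶ evalObj ob Y))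
    (leaf : ∀ x : L, Canon N (op (ob x)) (p x))
    (hg : ∀ {X Y : Word L} (g : G X Y),
      (wordCanon (fun X => op (evalObj ob X)) rfl (fun _ _ => rfl) leaf Y).Preserves
        (wordCanon (fun X => op (evalObj ob X)) rfl (fun _ _ => rfl) leaf X)
        (gp g).symm (gm g).op)
    {X Y : Word L} (f : Hom G X Y) :
    (wordCanon (fun X => op (evalObj ob X)) rfl (fun _ _ => rfl) leaf Y).Preserves
      (wordCanon (fun X => op (evalObj ob X)) rfl (fun _ _ => rfl) leaf X)
      (f.perm p gp).symm (evalHom ob gm f).op := by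
  induction f with
  | id X => exact Canon.preserves_id _
  | comp f g hf hg => exact hg.comp hf
  | whiskerLeft X f hf => exact hf.whiskerLeft _
  | whiskerRight f Y hf => exact hf.whiskerRight _
  | assocHom X Y Z => exact Canon.preserves_associator_inv _ _ _
  | assocInv X Y Z => exact Canon.preserves_associator _ _ _
  | leftHom X => exact Canon.preserves_leftUnitor_inv _
  | leftInv X => exact Canon.preserves_leftUnitor _
  | rightHom X => exact Canon.preserves_rightUnitor_inv _
  | rightInv X => exact Canon.preserves_rightUnitor _
  | braid X Y => exact Canon.preserves_braiding _ _
  | gen g => exact hg g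

end WordCanonOp

/-! ### The two-level system of a word of words and its canonical maps. -/

section Formal

open Functor.LaxMonoidal

variable {T : Type w} {C : Type u} [Category.{v} C] [MonoidalCategory C] [SymmetricCategory C]
  {D : Type u₁} [Category.{v₁} D] [MonoidalCategory D] [SymmetricCategory D]

/-- The tensor system on letter occurrences in a word, with given values of letters. -/
noncomputable abbrev lettersSystem (ob : T → C) (W : Word T) :
    TensorSystem C (W.rel (p := fun _ => Unit) fun _ _ _ => True) :=
  wordSystem (fun x => letterSystem (ob x)) W

/-- The tensor system in `C` on letter occurrences in a word of words. -/
noncomputable abbrev flatSystem (ob : T → C) (X : Word (Word T)) :=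
  wordSystem (lettersSystem ob) X

/-- The value of a letter occurrence in a word of words. -/
abbrev flatLetter (ob : T → C) (X : Word (Word T)) :
    X.Pos (fun W => W.Pos fun _ => Unit) → C :=
  X.family fun W => W.family fun x _ => ob x

theorem hasLetters_flatSystem (ob : T → C) (X : Word (Word T)) :
    (flatSystem ob X).HasLetters (flatLetter ob X) :=
  hasLetters_wordSystem _ _ (hasLetters_wordSystem _ _ fun x => hasLetters_letterSystem (ob x)) X

variable (F : C ⥤ D) [F.LaxBraided] [IsIso (ε F)]

/-- The transfer from the tensor system in `D` of a word of words, in which the inner words are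
inserted by means of `F`, to the one in `C`. -/
noncomputable abbrev flatTransfer (ob : T → C) (X : Word (Word T)) :=
  wordTransfer (fun W => Transfer.point F (lettersSystem ob W)) X

variable (E : Word T → C) (hu : 𝟙_ C = E .unit) (ht : ∀ X Y, E X ⊗ E Y = E (X.tensor Y))

/-- The canonical maps to the values of words from the system of a word of words. -/
noncomputable abbrev innerCanon (X : Word (Word T)) (W : Word T) :
    Canon (flatSystem (fun x => E (.of x)) X) (E W) (W.Pos fun _ => Unit) :=
  wordCanon E hu ht (fun x => letterCanon
    (fun i => (hasLetters_flatSystem (fun x => E (.of x)) X i).some) (E (.of x))) W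

variable (E' : Word (Word T) → D) (hu' : 𝟙_ D = E' .unit)
  (ht' : ∀ X Y, E' X ⊗ E' Y = E' (X.tensor Y)) (hF : ∀ W, F.obj (E W) = E' (.of W))

/-- The canonical maps to the values of words of words from the system of a word of words. -/
noncomputable abbrev outerCanon (X Y : Word (Word T)) :=
  wordCanon E' hu' ht' (fun W =>
    ((innerCanon E hu ht X W).map (flatTransfer F (fun x => E (.of x)) X)).cast (hF W)) Y

theorem unique_outerCanon (X Y : Word (Word T)) :
    (outerCanon F E hu ht E' hu' ht' hF X Y).Unique :=
  unique_wordCanon _ _ _ (fun W => ((unique_wordCanon _ _ _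
    (fun _ => unique_letterCanon _ _) W).map _).cast (hF W)) Y

/-- Existence is needed for the identity labelling only: preservation by formal morphisms yields all
other canonical maps that are used. -/
theorem admits_outerCanon (X : Word (Word T)) :
    (outerCanon F E hu ht E' hu' ht' hF X X).Admits id := by
  have hX : ∀ i j : X.Pos (fun W => W.Pos fun _ => Unit),
      X.rel (fun W => W.rel fun _ _ _ => True) i j ↔ i = j :=
    Word.rel_iff_eq (Word.rel_iff_eq fun _ _ _ => by simp) X
  refine admits_wordCanon (l := flatLetter (fun x => E (.of x)) X)
    (f := fun W => W.family fun x _ => E (.of x)) (r' := fun _ _ _ => True) _ _ _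
    (fun W ℓ hℓ => Canon.Admits.cast (hF W) ?_) X id ⟨fun _ _ h => h, fun _ => rfl, fun _ _ => .rfl⟩
  -- In `C` the relation is equality on both sides, so injectivity of `ℓ` makes it separated for the
  -- inner word.
  obtain ⟨c, hc, _⟩ := admits_wordCanon (l := flatLetter (fun x => E (.of x)) X)
    (f := fun x _ => E (.of x)) (r' := fun _ _ _ => True) E hu ht
    (fun x ℓ hℓ => admits_letterCanon _ _ ℓ (hℓ.family_eq ())) W ℓ
    ⟨hℓ.injective, hℓ.family_eq, fun i j => (hX _ _).trans (hℓ.injective.eq_iff.trans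
      (Word.rel_iff_eq (fun _ _ _ => by simp) W i j).symm)⟩
  -- The labels of one term `Φ(W)` are pairwise related in the system in `D`, which makes the
  -- transfer over them invertible.
  have := isIso_wordTransfer_app (F := F)
    (fun W => Transfer.point F (lettersSystem (fun x => E (.of x)) W))
    (fun W K => inferInstanceAs (IsIso (𝟙 _))) X (Set.range ℓ) (by
      rintro _ ⟨i, rfl⟩ _ ⟨j, rfl⟩
      exact (hℓ.rel_iff i j).2 trivial)
  exact ⟨_, ⟨c, hc, rfl⟩, IsIso.comp_isIso' this inferInstance⟩

end Formal

/-! ### Coherence in the lax case. -/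

section

open Functor.LaxMonoidal

variable {C : Type u} [Category.{v} C] [MonoidalCategory C] [SymmetricCategory C]
  {D : Type u₁} [Category.{v₁} D] [MonoidalCategory D] [SymmetricCategory D]

theorem FreeSym.preserves_toCat_map (X : Word (Word C)) {W W' : FreeSym C} (f : W ⟶ W') :
    (innerCanon (evalObj fun c : C => c) rfl (fun _ _ => rfl) X W).Preserves
      (innerCanon (evalObj fun c : C => c) rfl (fun _ _ => rfl) X W') (FreeSym.perm f)
      ((FreeSym.toCat C).map f) := by
  obtain ⟨f⟩ := f
  exact preserves_evalHom (G := fun _ _ => PEmpty) (fun g => g.elim) (fun c : C => c)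
    (fun g => g.elim) _ (fun g => g.elim) f

/-- Formal morphisms with the same underlying permutation have the same value under a normal lax
symmetric monoidal functor. -/
theorem FreeLax.toCat_map_eq (F : C ⥤ D) [F.LaxBraided] [IsIso (ε F)] {X Y : FreeLax C}
    (φ ψ : X ⟶ Y) (h : FreeLax.perm φ = FreeLax.perm ψ) :
    (FreeLax.toCat F).map φ = (FreeLax.toCat F).map ψ := by
  obtain ⟨f⟩ := φ
  obtain ⟨g⟩ := ψ
  let q (Z : Word (FreeSym C)) := outerCanon F (evalObj fun c : C => c) rfl (fun _ _ => rfl)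
    (evalObj (FreeLax.toCatOb F)) rfl (fun _ _ => rfl) (fun _ => rfl) X Z
  have hq {Y Z : Word (FreeSym C)} (f : Hom (LaxGen C) Y Z) :
      (q Y).Preserves (q Z) (f.perm (fun W : FreeSym C => W.Pos) FreeLax.genPerm)
        (evalHom (FreeLax.toCatOb F) (FreeLax.toCatGen F) f) := by
    refine preserves_evalHom _ _ _ _ (fun g => ?_) f
    cases g with
    | map f => exact (FreeSym.preserves_toCat_map X f).map _
    | mu W W' => exact Canon.preserves_μ _ _ _
    | eps => exact Canon.preserves_ε _
    | epsInv => exact Canon.preserves_inv_ε _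
  obtain ⟨c, hc, _⟩ := admits_outerCanon F (evalObj fun c : C => c) rfl (fun _ _ => rfl)
    (evalObj (FreeLax.toCatOb F)) rfl (fun _ _ => rfl) (fun _ => rfl) X
  have hf := (hq f).of_id hc
  have hg := (hq g).of_id hc
  replace h : f.perm (fun W : FreeSym C => W.Pos) FreeLax.genPerm = g.perm _ FreeLax.genPerm := h
  -- Now `hf` and `hg` concern the same labelling, the inverse of the common permutation.
  rw [h] at hf
  exact (cancel_epi c).1 ((unique_outerCanon _ _ _ _ _ _ _ _ _ _).eq hf hg)

end

/-! ### Coherence in the oplax case, by passage to opposite categories. -/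

section

open Functor.OplaxMonoidal Opposite

variable {C : Type u} [Category.{v} C] [MonoidalCategory C] [SymmetricCategory C]
  {D : Type u₁} [Category.{v₁} D] [MonoidalCategory D] [SymmetricCategory D]

theorem FreeSym.preserves_op_toCat_map (X : Word (Word C)) {W W' : FreeSym C} (f : W ⟶ W') :
    (innerCanon (fun W => op (evalObj (fun c : C => c) W)) rfl (fun _ _ => rfl) X W').Preserves
      (innerCanon (fun W => op (evalObj (fun c : C => c) W)) rfl (fun _ _ => rfl) X W)
      (FreeSym.perm f).symm ((FreeSym.toCat C).map f).op := by
  obtain ⟨f⟩ := f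
  exact preserves_op_evalHom (G := fun _ _ => PEmpty) (fun g => g.elim) (fun c : C => c)
    (fun g => g.elim) _ (fun g => g.elim) f

instance (F : C ⥤ D) [OplaxSymmetric F] : F.op.LaxBraided where
  ε := (η F).op
  μ X Y := (δ F X.unop Y.unop).op
  μ_natural_left f X := Quiver.Hom.unop_inj (δ_natural_left F f.unop X.unop)
  μ_natural_right X f := Quiver.Hom.unop_inj (δ_natural_right F X.unop f.unop)
  associativity X Y Z := Quiver.Hom.unop_inj ((Category.assoc _ _ _).trans
    ((associativity_inv F X.unop Y.unop Z.unop).symm.trans (Category.assoc _ _ _).symm))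
  left_unitality X := Quiver.Hom.unop_inj
    ((oplax_left_unitality F X.unop).trans (Category.assoc _ _ _).symm)
  right_unitality X := Quiver.Hom.unop_inj
    ((oplax_right_unitality F X.unop).trans (Category.assoc _ _ _).symm)
  braided X Y := Quiver.Hom.unop_inj (OplaxSymmetric.braided Y.unop X.unop)

instance (F : C ⥤ D) [OplaxSymmetric F] [IsIso (η F)] : IsIso (Functor.LaxMonoidal.ε F.op) :=
  inferInstanceAs (IsIso (η F).op)

/-- Formal morphisms with the same underlying permutation have the same value under a normal oplax
symmetric monoidal functor. -/
theorem FreeOplax.toCat_map_eq (F : C ⥤ D) [OplaxSymmetric F] [IsIso (η F)] {X Y : FreeOplax C}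
    (φ ψ : X ⟶ Y) (h : FreeOplax.perm φ = FreeOplax.perm ψ) :
    (FreeOplax.toCat F).map φ = (FreeOplax.toCat F).map ψ := by
  obtain ⟨f⟩ := φ
  obtain ⟨g⟩ := ψ
  -- The system is that of the target `Y`, because in `Dᵒᵖ` the value of the formal morphism starts
  -- there.
  let q (Z : Word (FreeSym C)) := outerCanon F.op (fun W => op (evalObj (fun c : C => c) W)) rfl
    (fun _ _ => rfl) (fun X => op (evalObj (FreeOplax.toCatOb F) X)) rfl (fun _ _ => rfl)
    (fun _ => rfl) Y Z
  let t := flatTransfer F.op (fun c : C => op c) Y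
  have hq {Z Z' : Word (FreeSym C)} (f : Hom (OplaxGen C) Z Z') :
      (q Z').Preserves (q Z) (f.perm (fun W : FreeSym C => W.Pos) FreeOplax.genPerm).symm
        (evalHom (FreeOplax.toCatOb F) (FreeOplax.toCatGen F) f).op := by
    refine preserves_op_evalHom _ _ _ _ (fun g => ?_) f
    cases g with
    | map f => exact (FreeSym.preserves_op_toCat_map Y f).map t
    | delta W W' => exact Canon.preserves_μ t _ _
    | eta => exact Canon.preserves_ε t
    | etaInv =>
      have h : (asIso (η F)).inv.op = inv (Functor.LaxMonoidal.ε F.op) :=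
        IsIso.eq_inv_of_hom_inv_id (congrArg Quiver.Hom.op (asIso (η F)).inv_hom_id)
      have h' := Canon.preserves_inv_ε t
      rw [← h] at h'
      exact h'
  obtain ⟨c, hc, _⟩ := admits_outerCanon F.op (fun W => op (evalObj (fun c : C => c) W)) rfl
    (fun _ _ => rfl) (fun X => op (evalObj (FreeOplax.toCatOb F) X)) rfl (fun _ _ => rfl)
    (fun _ => rfl) Y
  have hf := (hq f).of_id hc
  have hg := (hq g).of_id hc
  replace h : f.perm (fun W : FreeSym C => W.Pos) FreeOplax.genPerm = g.perm _ FreeOplax.genPerm :=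
    h
  rw [h] at hf
  exact Quiver.Hom.op_inj ((cancel_epi c).1 ((unique_outerCanon _ _ _ _ _ _ _ _ _ _).eq hf hg))

end

/-! ### The localized comma category of finite sets -/

section Localization

/-- If a functor `S` to a thin category inverts `W` and has a section up to a natural
transformation in `W`, then the localization at `W` is thin. -/
theorem isThin_localization {A : Type u} [Category.{v} A] {B : Type u₁} [Category.{v₁} B]
    [Quiver.IsThin B] (W : MorphismProperty A) (S : A ⥤ B) (hS : W.IsInvertedBy S) (T : B ⥤ A)
    (τ : S ⋙ T ⟶ 𝟭 A) (hτ : ∀ X, W (τ.app X)) : Quiver.IsThin W.Localization := by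
  let R : W.Localization ⥤ B := Localization.lift S hS W.Q
  have (X : A) : IsIso ((Functor.whiskerRight τ W.Q).app X) :=
    Localization.inverts W.Q W _ (hτ X)
  have : IsIso (Functor.whiskerRight τ W.Q) := NatIso.isIso_of_isIso_app _
  let : Localization.Lifting W.Q W ((S ⋙ T) ⋙ W.Q) (R ⋙ T ⋙ W.Q) :=
    ⟨Functor.isoWhiskerRight (Localization.fac S hS W.Q) (T ⋙ W.Q)⟩
  let : Localization.Lifting W.Q W (𝟭 A ⋙ W.Q) (𝟭 W.Localization) := ⟨Iso.refl _⟩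
  let e : R ⋙ T ⋙ W.Q ≅ 𝟭 W.Localization :=
    Localization.liftNatIso W.Q W ((S ⋙ T) ⋙ W.Q) (𝟭 A ⋙ W.Q) _ _
      (asIso (Functor.whiskerRight τ W.Q))
  refine fun X Y => ⟨fun f g => ?_⟩
  -- Naturality of `e` recovers `f` from `R.map f`, a morphism of a thin category.
  have h (f : X ⟶ Y) : f = e.inv.app X ≫ (T ⋙ W.Q).map (R.map f) ≫ e.hom.app Y := by
    have := e.hom.naturality f
    simp only [Functor.id_map] at this
    rw [← Functor.comp_map, this]
    simp
  rw [h f, h g, Subsingleton.elim (R.map f) (R.map g)]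

variable {n : ℕ}

open FintypeCat

theorem under_w_apply {X Y : Under (Skeleton.mk.{0} n)} (f : X ⟶ Y) (i : ULift (Fin n)) :
    f.right (X.hom i) = Y.hom i :=
  congrFun (Under.w f) i

/-- Surjections onto a finite set, as a property of finite sets under `{1, …, n}`. -/
abbrev surjectiveUnder (n : ℕ) : ObjectProperty (Under (Skeleton.mk.{0} n)) :=
  fun X => Function.Surjective X.hom

theorem hom_eq_of_surjective {X Y : Under (Skeleton.mk.{0} n)} (hX : Function.Surjective X.hom)
    (f g : X ⟶ Y) : f = g := by
  apply Under.UnderMorphism.ext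
  funext x
  obtain ⟨i, rfl⟩ := hX x
  exact (under_w_apply f i).trans (under_w_apply g i).symm

instance : Quiver.IsThin (surjectiveUnder n).FullSubcategory := fun X _ =>
  ⟨fun f g => ObjectProperty.hom_ext _ (hom_eq_of_surjective X.property f.hom g.hom)⟩

/-- The image of `k` in `X` must go to the image of `k` in `Y`. This is well defined: numbers
identified in `X` are identified in `Z`, and injectivity of `i` reflects this to `Y`. -/
theorem exists_lift_of_surjective {X Y Z : Under (Skeleton.mk.{0} n)}
    (hX : Function.Surjective X.hom) (f : X ⟶ Z) (i : Y ⟶ Z) (hi : Function.Injective i.right) :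
    Nonempty (X ⟶ Y) := by
  choose s hs using hX
  refine ⟨Under.homMk (fun x => Y.hom (s x)) (funext fun x => hi ?_)⟩
  change i.right (Y.hom (s (X.hom x))) = i.right (Y.hom x)
  exact (under_w_apply i _).trans ((under_w_apply f _).symm.trans
    ((congrArg f.right (hs _)).trans ((under_w_apply f x).trans (under_w_apply i x).symm)))

theorem injective_of_injMono {X Y : Under (Skeleton.mk.{0} n)} {f : X ⟶ Y} (hf : injMono n f) :
    Function.Injective f.right := by
  obtain ⟨φ, hφ, h⟩ := hf
  rintro ⟨i⟩ ⟨j⟩ hij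
  rw [h, h] at hij
  rw [hφ.injective (ULift.up_injective hij)]

theorem exists_image (X : Under (Skeleton.mk.{0} n)) :
    ∃ (Y : (surjectiveUnder n).FullSubcategory) (i : Y.obj ⟶ X), injMono n i := by
  classical
  let s : Finset (Fin X.right.len) := Finset.univ.image fun i : Fin n => (X.hom ⟨i⟩).down
  -- Enumerating the image increasingly makes its inclusion order-preserving, as `injMono` demands.
  let e := s.orderIsoOfFin rfl
  have hs (i : ULift.{0} (Fin n)) : (X.hom i).down ∈ s :=
    Finset.mem_image_of_mem _ (Finset.mem_univ i.down)
  let Y : Under (Skeleton.mk.{0} n) :=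
    Under.mk (Y := Skeleton.mk.{0} s.card) fun i => ⟨e.symm ⟨(X.hom i).down, hs i⟩⟩
  refine ⟨⟨Y, ?_⟩, Under.homMk (fun j => ⟨(e j.down).1⟩) ?_, fun j => (e j).1, ?_, fun _ => rfl⟩
  · rintro ⟨j⟩
    obtain ⟨i, -, hi⟩ := Finset.mem_image.1 (e j).2
    refine ⟨⟨i⟩, congrArg ULift.up ?_⟩
    exact e.symm_apply_eq.2 (Subtype.ext hi)
  · funext i
    exact congrArg ULift.up (congrArg Subtype.val (e.apply_symm_apply _))
  · exact fun i j hij => e.strictMono hij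

theorem isThin_injMono_localization (n : ℕ) : Quiver.IsThin (injMono n).Localization := by
  choose Y i hi using exists_image (n := n)
  have lift {X X' : Under (Skeleton.mk.{0} n)} (f : X ⟶ X') : Nonempty (Y X ⟶ Y X') :=
    (exists_lift_of_surjective (Y X).property (i X ≫ f) (i X')
      (injective_of_injMono (hi X'))).map ObjectProperty.homMk
  -- Mere existence of lifts suffices: functoriality and naturality are automatic, since maps out of
  -- surjective objects are unique.
  let S : Under (Skeleton.mk.{0} n) ⥤ (surjectiveUnder n).FullSubcategory :=
    { obj := Y
      map f := (lift f).some
      map_id _ := Subsingleton.elim _ _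
      map_comp _ _ := Subsingleton.elim _ _ }
  refine isThin_localization (injMono n) S (fun X X' f hf => ?_) (surjectiveUnder n).ι
    { app := i, naturality := fun X X' f => hom_eq_of_surjective (Y X).property _ _ } hi
  -- For injective `f` the image in `X'` also lifts to the image in `X`; thinness makes this lift
  -- inverse to `S.map f`.
  obtain ⟨g⟩ := exists_lift_of_surjective (Y X').property (i X') (i X ≫ f)
    ((injective_of_injMono hf).comp (injective_of_injMono (hi X)))
  exact ⟨ObjectProperty.homMk g, Subsingleton.elim _ _, Subsingleton.elim _ _⟩

end Localization

end SymCoh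

theorem mainTheorem9
    {C : Type u} [Category.{v} C] [MonoidalCategory C] [SymmetricCategory C]
    {D : Type u₁} [Category.{v₁} D] [MonoidalCategory D] [SymmetricCategory D] :
    (∀ (F : C ⥤ D) [F.LaxBraided] [IsIso (Functor.LaxMonoidal.ε F)]
      {J : Type w} [Category.{w'} J] (Δ : J ⥤ D),
        SymCoh.LaxExpectedToCommute F Δ → SymCoh.Commutes Δ) ∧
    (∀ (F : C ⥤ D) [SymCoh.OplaxSymmetric F] [IsIso (Functor.OplaxMonoidal.η F)]
      {J : Type w} [Category.{w'} J] (Δ : J ⥤ D),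
        SymCoh.OplaxExpectedToCommute F Δ → SymCoh.Commutes Δ) ∧
    ∀ n : ℕ, Quiver.IsThin (SymCoh.injMono n).Localization := by
  refine ⟨?_, ?_, SymCoh.isThin_injMono_localization⟩
  · rintro F _ _ J _ _ ⟨K, rfl, hK⟩ a b f g
    exact SymCoh.FreeLax.toCat_map_eq F _ _ (hK f g)
  · rintro F _ _ J _ _ ⟨K, rfl, hK⟩ a b f g
    exact SymCoh.FreeOplax.toCat_map_eq F _ _ (hK f g)
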